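/- Let $q\ge 1$ and let $\mathbb T$ be the Bethe lattice in which every vertex has degree $q+1$ (the tree all of whose vertices have $q+1$ neighbours). Let $\Omega$ be a finite set. For a subgraph $H$ of $\mathbb T$ put $X_H=\Omega^H$, let $X=\Omega^{\mathbb T}$, and write $\eta_H$ for the restriction of a configuration $\eta$ to $H$; for a measure $\mu$ on $X$ let $\mu_H$ be its marginal on $X_H$, and write $\mu_H(\xi)$ for the mass of a single configuration $\xi$. A full subgraph of diameter $k$ is a maximal element among the subgraphs of $\mathbb T$ of diameter $k$; any two of them are isomorphic. A probability measure $\nu$ on $X_H$ is locally invariant if for all connected subgraphs $H_1,H_2$ of $H$ and every isomorphism $\phi:H_1\to H_2$ the mapping $\xi\mapsto\xi\circ\phi$ from $X_{H_2}$ to $X_{H_1}$ carries the marginal of $\nu$ on $X_{H_2}$ to the marginal of $\nu$ on $X_{H_1}$. Theorem. Let $k\ge 0$, let $T_k$ be a full subgraph of diameter $k$, and let $\mu_k$ be a locally invariant probability measure on $X_{T_k}$. Then there is a probability measure $\mu$ on $X$ that is invariant under all automorphisms of $\mathbb T$, has marginal $\mu_k$ on $X_{T_k}$, and satisfies the following symmetrized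 Markov formula for every $j\ge k$. Let $S$ and $T$ be full subgraphs of diameters $j+1$ and $j$, and let $r_j=2$ if $j$ is even and $r_j=q+1$ if $j$ is odd. Then $S$ contains exactly $r_j$ full subgraphs $C_1,\dots,C_{r_j}$ of diameter $j$, all isomorphic to $T$, and their intersection $D$ is a full subgraph of diameter $j-1$ (empty if $j=0$). For any isomorphisms $\phi_i:C_i\to T$, let $\mu^i$ be the copy on $X_{C_i}$ of the marginal $\mu_T$, that is, its image under $\xi\mapsto\xi\circ\phi_i$. Then for every configuration $\eta\in X$ $$\mu_S(\eta_S)=\mu_D(\eta_D)^{-(r_j-1)}\prod_{i=1}^{r_j}\mu^i(\eta_{C_i}) =\mu_D(\eta_D)\prod_{i=1}^{r_j}\mu^i\bigl(\eta_{C_i\setminus D}\mid\eta_D\bigr),$$ where both right-hand sides are read as $0$ if $\mu_D(\eta_D)=0$. -/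

import Mathlib

open MeasureTheory ProbabilityTheory

namespace BetheExtension

variable {V : Type*} {Ω : Type*} {G : SimpleGraph V}

/-- The Bethe lattice in which every vertex has degree `q + 1`: the (unique up to isomorphism)
tree all of whose vertices have `q + 1` neighbours. It is infinite as soon as `1 ≤ q`. -/
structure IsBetheLattice (q : ℕ) (G : SimpleGraph V) [G.LocallyFinite] : Prop where
  isTree : G.IsTree
  regular : G.IsRegularOfDegree (q + 1)

/-- The space `X_H = Ω^H` of configurations on a subgraph `H`. -/
abbrev Config (Ω : Type*) (H : G.Subgraph) : Type _ := H.verts → Ω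

/-- The restriction `η_H` of a configuration `η` on the whole lattice to a subgraph `H`. -/
def restr (H : G.Subgraph) (η : V → Ω) : Config Ω H := fun x => η x

/-- The restriction of a configuration on `H` to a subgraph `K` of `H`. -/
def restrSub {K H : G.Subgraph} (h : K ≤ H) (η : Config Ω H) : Config Ω K :=
  fun x => η ⟨x, h.1 x.2⟩

/-- The marginal on `X_H` of a measure on the configurations of the whole lattice. -/
noncomputable def marginal [MeasurableSpace Ω] (μ : Measure (V → Ω)) (H : G.Subgraph) :
    Measure (Config Ω H) :=
  μ.map (restr H)

/-- The marginal on `X_K` of a measure on `X_H`, for a subgraph `K` of `H`. -/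
noncomputable def marginalSub [MeasurableSpace Ω] {K H : G.Subgraph} (h : K ≤ H)
    (ν : Measure (Config Ω H)) : Measure (Config Ω K) :=
  ν.map (restrSub h)

/-- The copy on `X_K` of a measure on `X_H` under an isomorphism `φ : K → H`: the image of the
measure under the induced mapping `ξ ↦ ξ ∘ φ` of configurations. -/
noncomputable def copy [MeasurableSpace Ω] {K H : G.Subgraph} (φ : K.coe ≃g H.coe)
    (ν : Measure (Config Ω H)) : Measure (Config Ω K) :=
  ν.map (fun ξ x => ξ (φ x))

/-- Local invariance of a measure on `X_H`: isomorphisms between connected subgraphs of `H` carry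
the marginals of the measure into each other. -/
def LocallyInvariant [MeasurableSpace Ω] (H : G.Subgraph) (ν : Measure (Config Ω H)) : Prop :=
  ∀ (H₁ H₂ : G.Subgraph) (h₁ : H₁ ≤ H) (h₂ : H₂ ≤ H), H₁.Connected → H₂.Connected →
    ∀ φ : H₁.coe ≃g H₂.coe, copy φ (marginalSub h₂ ν) = marginalSub h₁ ν

/-- Invariance of a measure under the group of all automorphisms of the lattice. -/
def Invariant [MeasurableSpace Ω] (G : SimpleGraph V) (μ : Measure (V → Ω)) : Prop :=
  ∀ φ : G ≃g G, μ.map (fun η x => η (φ x)) = μ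

/-- Full subgraphs of diameter `k`: the maximal subgraphs of diameter `k`. The diameter is
the `ℕ∞`-valued one, which is `⊤` for a disconnected subgraph. -/
def IsFull (k : ℕ) (H : G.Subgraph) : Prop :=
  Maximal (fun K : G.Subgraph => K.coe.ediam = (k : ℕ∞)) H

/-- The number `r_j` of full subgraphs of diameter `j` in one of diameter `j + 1`. -/
def numCopies (q j : ℕ) : ℕ := if Even j then 2 else q + 1

/-- The symmetrized Markov formula from diameter `j` to diameter `j + 1`.
For full subgraphs `S` of diameter `j + 1` and `T` of diameter `j`, let `C 1, …, C r` be the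
copies of `T` in `S`; their intersection `D` is a full subgraph of diameter `j - 1` (empty when
`j = 0`). Let `μⁱ` be the copy on `C i` of the marginal of `μ` on `T`, taken along any isomorphism.
Then, for every configuration `η`,
`μ(η_S) = μ(η_D)^{-(r-1)} ∏ i, μⁱ(η_{C i})` and
`μ(η_S) = μ(η_D) ∏ i, μⁱ(η_{C i \ D} | η_D)`.
Both right-hand sides are zero when `μ(η_D) = 0`: in the first because `0⁻¹ = 0` and `r ≥ 2`, in the
second already through its first factor. -/
def SymmetrizedMarkov [MeasurableSpace Ω] (G : SimpleGraph V) (q j : ℕ)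
    (μ : Measure (V → Ω)) : Prop :=
  ∀ S T : G.Subgraph, IsFull (j + 1) S → IsFull j T →
    ∃ (C : Fin (numCopies q j) → G.Subgraph) (D : G.Subgraph),
      Function.Injective C ∧
      Set.range C = {K : G.Subgraph | IsFull j K ∧ K ≤ S} ∧
      D = ⨅ i, C i ∧
      (j = 0 → D = ⊥) ∧
      (∀ l : ℕ, j = l + 1 → IsFull l D) ∧
      (∀ i, Nonempty ((C i).coe ≃g T.coe)) ∧
      ∀ (φ : ∀ i, (C i).coe ≃g T.coe) (η : V → Ω),
        (marginal μ S).real {restr S η} =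
            ((marginal μ D).real {restr D η} ^ (numCopies q j - 1))⁻¹ *
              ∏ i, (copy (φ i) (marginal μ T)).real {restr (C i) η} ∧
        (marginal μ S).real {restr S η} =
            (marginal μ D).real {restr D η} *
              ∏ i, (ProbabilityTheory.cond (copy (φ i) (marginal μ T))
                  {ξ | ∀ x : (C i).verts, (x : V) ∈ D.verts → ξ x = η x}).real
                {ξ | ∀ x : (C i).verts, (x : V) ∉ D.verts → ξ x = η x}

end BetheExtension

/-! A full subgraph is a ball, about a vertex if its diameter is even and about an edge if it is
odd; `isFull_iff` obtains this by prolonging geodesics beyond the centre, which is possible because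
all degrees are at least 2. Describing the ball of diameter `j` by `dist x v + dist y v ≤ j`, with
`x = y` or `x` adjacent to `y`, treats both parities at once.

The geometric fact behind the theorem is a sunflower (`isSunflower_coreSet`): the balls of diameter
`j` inside a ball `S` of diameter `j + 1` cover `S`, and any two of them meet in the same set `D`,
the concentric ball of diameter `j - 1`. Laws on these petals that agree on `D` can therefore be
made conditionally independent given `D` (`exists_amalgamation`), and the Markov product is the
resulting mass of a configuration.

This step can be iterated (`exists_isMarkovExtension`). The product depends only on the petal laws
and is symmetric in them, so isometry invariance passes to diameter `j + 1`. The new laws are again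
consistent: two balls of diameter `j + 1` in one of diameter `j + 2` meet in a ball of diameter `j`,
where both restrict to the old law. Local invariance of the given measure starts the iteration.
Compactness gives a limit along balls exhausting the tree; it has the prescribed law on every ball,
wherever centred, since each ball grows step by step into one of the exhausting balls
(`exists_agreeOn_exhaust`). Invariance under automorphisms is then checked on finite sets.

Throughout, a law on a ball is represented by a measure on all configurations of which only the
marginal on the ball matters (`AgreeOn`), and an isomorphism of balls by a self-map of `V` that is
isometric on the ball. -/

namespace BetheExtension

/-! ### Geodesics, convexity and balls in a tree -/

section TreeMetric

variable {V : Type*} {G : SimpleGraph V}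

/-- In a connected graph every vertex other than `z` has a neighbour closer to `z`. -/
theorem exists_adj_dist_eq (hG : G.Connected) {z v : V} (h : v ≠ z) :
    ∃ w, G.Adj v w ∧ G.dist z v = G.dist z w + 1 := by
  obtain ⟨p, hp⟩ := hG.exists_walk_length_eq_dist v z
  cases p with
  | nil => exact absurd rfl h
  | @cons _ w _ hvw q =>
    refine ⟨w, hvw, ?_⟩
    have h1 := SimpleGraph.dist_le q
    have h2 := hG.dist_triangle (u := v) (v := w) (w := z)
    have h3 : G.dist v w = 1 := SimpleGraph.dist_eq_one_iff_adj.2 hvw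
    rw [SimpleGraph.Walk.length_cons] at hp
    rw [G.dist_comm (u := z) (v := v), G.dist_comm (u := z) (v := w)]
    omega

/-- In a tree the neighbour of `v` closer to `z` is unique. -/
theorem adj_eq_of_dist_eq (hG : G.IsTree) {z v w w' : V} (hw : G.Adj v w) (hw' : G.Adj v w')
    (h : G.dist z v = G.dist z w + 1) (h' : G.dist z v = G.dist z w' + 1) : w = w' := by
  obtain ⟨p, -, hpl⟩ := hG.connected.exists_path_of_dist w z
  obtain ⟨p', -, hpl'⟩ := hG.connected.exists_path_of_dist w' z
  have e : G.dist v z = G.dist z v := G.dist_comm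
  have e1 : G.dist w z = G.dist z w := G.dist_comm
  have e2 : G.dist w' z = G.dist z w' := G.dist_comm
  have hq := (p.cons hw).isPath_of_length_eq_dist (by
    rw [SimpleGraph.Walk.length_cons]; omega)
  have hq' := (p'.cons hw').isPath_of_length_eq_dist (by
    rw [SimpleGraph.Walk.length_cons]; omega)
  have := (hG.existsUnique_path v z).unique hq hq'
  simpa using congrArg SimpleGraph.Walk.snd this

/-- Two geodesics overlapping in an edge combine to a geodesic. -/
theorem dist_eq_add_of_adj (hG : G.IsTree) {w x y v : V} (hxy : G.Adj x y)
    (h : G.dist w y = G.dist w x + 1) (h' : G.dist x v = G.dist y v + 1) :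
    G.dist w v = G.dist w y + G.dist y v := by
  induction hn : G.dist y v generalizing x y with
  | zero =>
    rw [(hG.connected.dist_eq_zero_iff).1 hn]; rfl
  | succ n ih =>
    have hne : y ≠ v := by rintro rfl; simp at hn
    obtain ⟨z, hyz, hz⟩ := exists_adj_dist_eq hG.connected hne
    have e : G.dist v y = G.dist y v := G.dist_comm
    have e1 : G.dist v z = G.dist z v := G.dist_comm
    have hwz : G.dist w z = G.dist w y + 1 := by
      rcases hG.dist_eq_dist_add_one_of_adj w hyz with h1 | h1
      · have := adj_eq_of_dist_eq hG hyz hxy.symm h1 h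
        subst this
        omega
      · exact h1
    have := ih hyz hwz (by omega) (by omega)
    omega

/-- A set of vertices containing the geodesics between its points. -/
def GeodConvex (G : SimpleGraph V) (A : Set V) : Prop :=
  ∀ z ∈ A, ∀ v ∈ A, ∀ w, G.Adj v w → G.dist z v = G.dist z w + 1 → w ∈ A

/-- A map preserving the distances between the points of `A`. -/
def IsometricOn (G : SimpleGraph V) (f : V → V) (A : Set V) : Prop :=
  ∀ u ∈ A, ∀ v ∈ A, G.dist (f u) (f v) = G.dist u v

theorem IsometricOn.mono {f : V → V} {A B : Set V} (h : IsometricOn G f B) (hAB : A ⊆ B) :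
    IsometricOn G f A :=
  fun u hu v hv => h u (hAB hu) v (hAB hv)

theorem IsometricOn.injOn (hG : G.Connected) {f : V → V} {A : Set V} (h : IsometricOn G f A) :
    Set.InjOn f A := by
  intro u hu v hv huv
  have := h u hu v hv
  rw [huv, SimpleGraph.dist_self] at this
  exact (hG.dist_eq_zero_iff).1 this.symm

theorem IsometricOn.adj {f : V → V} {A : Set V} (h : IsometricOn G f A) {u v : V} (hu : u ∈ A)
    (hv : v ∈ A) (huv : G.Adj u v) : G.Adj (f u) (f v) := by
  rw [← SimpleGraph.dist_eq_one_iff_adj, h u hu v hv, SimpleGraph.dist_eq_one_iff_adj]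
  exact huv

theorem isometricOn_id (A : Set V) : IsometricOn G id A := fun _ _ _ _ => rfl

theorem IsometricOn.comp {f g : V → V} {A B : Set V} (hf : IsometricOn G f A)
    (hg : IsometricOn G g B) (hAB : Set.MapsTo f A B) : IsometricOn G (g ∘ f) A := by
  intro u hu v hv
  rw [Function.comp_apply, Function.comp_apply, hg _ (hAB hu) _ (hAB hv), hf u hu v hv]

/-- In a tree, locally injective homomorphisms are isometric. -/
theorem isometricOn_of_locallyInjective (hG : G.IsTree) {f : V → V} {A : Set V}
    (hA : GeodConvex G A) (hadj : ∀ u ∈ A, ∀ v ∈ A, G.Adj u v → G.Adj (f u) (f v))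
    (hinj : ∀ v ∈ A, ∀ u ∈ A, ∀ w ∈ A, G.Adj v u → G.Adj v w → f u = f w → u = w) :
    IsometricOn G f A := by
  intro u hu v hv
  induction hn : G.dist u v using Nat.strong_induction_on generalizing v with
  | _ n ih =>
    by_cases hvu : v = u
    · subst hvu; simpa using hn
    obtain ⟨w, hvw, hw⟩ := exists_adj_dist_eq hG.connected hvu
    have hwA := hA u hu v hv w hvw hw
    have h1 := ih _ (by omega) w hwA rfl
    have hfvw := hadj v hv w hwA hvw
    by_cases hwu : w = u
    · subst hwu
      rw [SimpleGraph.dist_self] at hw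
      rw [← hn, hw, G.dist_comm]
      simpa using hfvw
    obtain ⟨p, hwp, hp⟩ := exists_adj_dist_eq hG.connected hwu
    have hpA := hA u hu w hwA p hwp hp
    have h2 := ih _ (by omega) p hpA rfl
    have hpv : p ≠ v := by rintro rfl; omega
    -- If the image turned back at `f w`, then `f v` and `f p` would both be the neighbour of `f w`
    -- closer to `f u`, against local injectivity at `w`.
    rcases hG.dist_eq_dist_add_one_of_adj (f u) hfvw with h3 | h3
    · omega
    · have h4 := adj_eq_of_dist_eq hG (hadj w hwA p hpA hwp) hfvw.symm (by omega) h3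
      exact absurd (hinj w hwA p hpA v hv hwp hvw.symm h4) hpv

/-- The ball of diameter `j` about a vertex (`x = y`) or an edge (`x` adjacent to `y`). -/
def fullSet (G : SimpleGraph V) (j : ℕ) (x y : V) : Set V :=
  {v | G.dist x v + G.dist y v ≤ j}

/-- The centre of a ball of diameter `j` is a vertex or an edge according to the parity of `j`. -/
def IsCenter (G : SimpleGraph V) (j : ℕ) (x y : V) : Prop :=
  (Even j ∧ x = y) ∨ (Odd j ∧ G.Adj x y)

/-- The sets of vertices of the full subgraphs of diameter `j`. -/
def IsFullSet (G : SimpleGraph V) (j : ℕ) (A : Set V) : Prop :=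
  ∃ x y, IsCenter G j x y ∧ A = fullSet G j x y

theorem mem_fullSet {j : ℕ} {x y v : V} :
    v ∈ fullSet G j x y ↔ G.dist x v + G.dist y v ≤ j := Iff.rfl

theorem fullSet_comm (j : ℕ) (x y : V) : fullSet G j x y = fullSet G j y x := by
  ext v; simp only [mem_fullSet]; omega

theorem IsCenter.symm {j : ℕ} {x y : V} (h : IsCenter G j x y) : IsCenter G j y x :=
  h.imp (fun h => ⟨h.1, h.2.symm⟩) (fun h => ⟨h.1, h.2.symm⟩)

theorem IsCenter.dist_le {j : ℕ} {x y : V} (h : IsCenter G j x y) : G.dist x y ≤ j := by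
  rcases h with ⟨-, rfl⟩ | ⟨h, h'⟩
  · simp
  · rw [SimpleGraph.dist_eq_one_iff_adj.2 h']; exact h.pos

theorem IsCenter.left_mem {j : ℕ} {x y : V} (h : IsCenter G j x y) : x ∈ fullSet G j x y := by
  have := h.dist_le
  rw [mem_fullSet, SimpleGraph.dist_self, G.dist_comm]; omega

theorem IsCenter.right_mem {j : ℕ} {x y : V} (h : IsCenter G j x y) : y ∈ fullSet G j x y := by
  have := h.dist_le
  rw [mem_fullSet, SimpleGraph.dist_self]; omega

theorem IsCenter.add_two_iff {j : ℕ} {x y : V} : IsCenter G (j + 2) x y ↔ IsCenter G j x y := by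
  simp [IsCenter, Nat.even_add, parity_simps]

theorem IsFullSet.nonempty {j : ℕ} {A : Set V} (h : IsFullSet G j A) : A.Nonempty := by
  obtain ⟨x, y, h, rfl⟩ := h
  exact ⟨x, h.left_mem⟩

theorem fullSet_mono {i j : ℕ} (h : i ≤ j) (x y : V) : fullSet G i x y ⊆ fullSet G j x y :=
  fun _ hv => le_trans hv h

/-- A step from `v` towards `z` raises the sum of the distances only if it leads away from both `x`
and `y`. Then the geodesics from `x` and `y` to `z` pass through `w`, and the bound at `z` gives the
bound at `w`. -/
theorem geodConvex_fullSet (hG : G.IsTree) (j : ℕ) (x y : V) : GeodConvex G (fullSet G j x y) := by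
  intro z hz v hv w hvw hw
  rw [mem_fullSet] at *
  have e : G.dist v z = G.dist z v := G.dist_comm
  have e1 : G.dist w z = G.dist z w := G.dist_comm
  rcases hG.dist_eq_dist_add_one_of_adj x hvw with h1 | h1 <;>
    rcases hG.dist_eq_dist_add_one_of_adj y hvw with h2 | h2
  · omega
  · omega
  · omega
  · have h3 := dist_eq_add_of_adj hG hvw h1 (v := z) (by omega)
    have h4 := dist_eq_add_of_adj hG hvw h2 (v := z) (by omega)
    omega

theorem IsFullSet.geodConvex (hG : G.IsTree) {j : ℕ} {A : Set V} (h : IsFullSet G j A) :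
    GeodConvex G A := by
  obtain ⟨x, y, -, rfl⟩ := h
  exact geodConvex_fullSet hG j x y

theorem finite_dist_le (hG : G.Connected) [G.LocallyFinite] (x : V) (n : ℕ) :
    {v | G.dist x v ≤ n}.Finite := by
  induction n with
  | zero =>
    refine (Set.finite_singleton x).subset fun v hv => ?_
    exact ((hG.dist_eq_zero_iff).1 (Nat.le_zero.1 hv)).symm
  | succ n ih =>
    refine (ih.union (ih.biUnion fun v _ => (G.neighborSet v).toFinite)).subset fun v hv => ?_
    by_cases hvx : v = x
    · left; simp [hvx]
    obtain ⟨w, hvw, hw⟩ := exists_adj_dist_eq hG hvx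
    right
    have hv' : G.dist x v ≤ n + 1 := hv
    exact Set.mem_biUnion (show G.dist x w ≤ n by omega) hvw.symm

theorem IsFullSet.finite (hG : G.Connected) [G.LocallyFinite] {j : ℕ} {A : Set V}
    (h : IsFullSet G j A) : A.Finite := by
  obtain ⟨x, y, -, rfl⟩ := h
  exact (finite_dist_le hG x j).subset fun v hv => le_trans (Nat.le_add_right _ _) hv

/-- Outside the centre, a vertex has a neighbour closer to both points of the centre. -/
theorem exists_adj_closer_center (hG : G.IsTree) {j : ℕ} {x y u : V} (h : IsCenter G j x y)
    (hx : u ≠ x) (hy : u ≠ y) :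
    ∃ w, G.Adj u w ∧ G.dist x u = G.dist x w + 1 ∧ G.dist y u = G.dist y w + 1 := by
  obtain ⟨w, h1, h2⟩ := exists_adj_dist_eq hG.connected hx
  rcases h with ⟨-, rfl⟩ | ⟨-, h⟩
  · exact ⟨w, h1, h2, h2⟩
  · obtain ⟨w', h1', h2'⟩ := exists_adj_dist_eq hG.connected hy
    have t0 := hG.dist_eq_dist_add_one_of_adj u h
    have t1 := hG.dist_eq_dist_add_one_of_adj w h
    have t2 := hG.dist_eq_dist_add_one_of_adj w' h
    have t3 := hG.dist_eq_dist_add_one_of_adj y h1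
    have t4 := hG.dist_eq_dist_add_one_of_adj x h1'
    simp only [G.dist_comm (u := w), G.dist_comm (u := w'), G.dist_comm (u := u)] at t0 t1 t2
    -- The neighbour towards the farther end of the edge also approaches the nearer end; `w` fails
    -- only if `y` is the nearer end, and then `w'` serves as well, being the same neighbour by
    -- uniqueness or not.
    by_cases hw : G.dist y u = G.dist y w + 1
    · exact ⟨w, h1, h2, hw⟩
    · exact ⟨w', h1', by omega, h2'⟩

/-- A geodesic into the centre can be prolonged by a given length. -/
theorem exists_prolongation (hG : G.IsTree) {q : ℕ} (hq : 1 ≤ q) [G.LocallyFinite]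
    (hreg : G.IsRegularOfDegree (q + 1)) {j : ℕ} {x y : V} (h : IsCenter G j x y) (w : V) :
    ∃ u, G.dist x u + G.dist y u = j ∧ 2 * G.dist w u = G.dist x w + G.dist y w + j := by
  induction j using Nat.twoStepInduction with
  | zero =>
    rcases h with ⟨-, rfl⟩ | ⟨h, -⟩
    · refine ⟨x, by simp, ?_⟩
      rw [G.dist_comm (u := w)]; omega
    · simp at h
  | one =>
    rcases h with ⟨h, -⟩ | ⟨-, h⟩
    · simp at h
    · have h1 := SimpleGraph.dist_eq_one_iff_adj.2 h
      have h2 := SimpleGraph.dist_eq_one_iff_adj.2 h.symm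
      have e : G.dist w x = G.dist x w := G.dist_comm
      have e' : G.dist w y = G.dist y w := G.dist_comm
      rcases hG.dist_eq_dist_add_one_of_adj w h with h3 | h3
      · exact ⟨x, by simp [h2], by omega⟩
      · exact ⟨y, by simp [h1], by omega⟩
  | more j ih _ =>
    obtain ⟨u, hu, hwu⟩ := ih (IsCenter.add_two_iff.1 h)
    -- Of two neighbours of `u` at most one is closer to `w`.
    obtain ⟨u', huu', hwu'⟩ : ∃ u', G.Adj u u' ∧ G.dist w u' = G.dist w u + 1 := by
      have hcard : 1 < (G.neighborFinset u).card := by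
        rw [G.card_neighborFinset_eq_degree, hreg u]; omega
      obtain ⟨a, ha, b, hb, hab⟩ := Finset.one_lt_card.1 hcard
      rw [SimpleGraph.mem_neighborFinset] at ha hb
      rcases hG.dist_eq_dist_add_one_of_adj w ha with h1 | h1
      · rcases hG.dist_eq_dist_add_one_of_adj w hb with h2 | h2
        · exact absurd (adj_eq_of_dist_eq hG ha hb h1 h2) hab
        · exact ⟨b, hb, h2⟩
      · exact ⟨a, ha, h1⟩
    refine ⟨u', ?_, by omega⟩
    -- Adjacency bounds the sum of the distances of `u'` to the centre by `j + 2`; the triangle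
    -- inequality through `x` and `y` bounds it from below.
    have t1 := huu'.diff_dist_adj (u := x)
    have t2 := huu'.diff_dist_adj (u := y)
    have t3 := hG.connected.dist_triangle (u := w) (v := x) (w := u')
    have t4 := hG.connected.dist_triangle (u := w) (v := y) (w := u')
    rw [G.dist_comm (u := w) (v := x)] at t3
    rw [G.dist_comm (u := w) (v := y)] at t4
    omega

end TreeMetric

/-! ### Isometries between balls, and the sunflower of sub-balls -/

section FullSets

variable {V : Type*} {G : SimpleGraph V}

/-- A map that is isometric on a ball extends to an isometric map on the next larger ball with the
same centre. -/
theorem exists_isometricOn_add_two (hG : G.IsTree) {q : ℕ} [G.LocallyFinite]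
    (hreg : G.IsRegularOfDegree (q + 1)) {j : ℕ} {x y : V} (h : IsCenter G j x y) {f : V → V}
    (hf : IsometricOn G f (fullSet G j x y)) :
    ∃ g : V → V, Set.EqOn g f (fullSet G j x y) ∧ IsometricOn G g (fullSet G (j + 2) x y) := by
  classical
  set A := fullSet G j x y with hA
  set B := fullSet G (j + 2) x y with hB
  have hAB : A ⊆ B := fullSet_mono (by omega) x y
  have hpar : ∀ u, ∃ w, u ∈ B → u ∉ A → G.Adj u w ∧ w ∈ A ∧
      G.dist x u = G.dist x w + 1 ∧ G.dist y u = G.dist y w + 1 := by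
    intro u
    by_cases hu : u ∈ A
    · exact ⟨u, fun _ h => absurd hu h⟩
    obtain ⟨w, h1, h2, h3⟩ := exists_adj_closer_center hG h
      (ne_of_mem_of_not_mem h.left_mem hu).symm (ne_of_mem_of_not_mem h.right_mem hu).symm
    refine ⟨w, fun hu' _ => ⟨h1, ?_, h2, h3⟩⟩
    rw [hB, mem_fullSet] at hu'
    rw [hA, mem_fullSet]
    omega
  choose p hp using hpar
  -- Since `v` and `f v` have equal degrees, `f` on the neighbours of `v` in `A` extends to a
  -- bijection between all neighbours of `v` and of `f v`.
  have hσ : ∀ v, ∃ σ : V → V, v ∈ A → (∀ u, G.Adj v u → G.Adj (f v) (σ u)) ∧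
      (∀ u w, G.Adj v u → G.Adj v w → σ u = σ w → u = w) ∧ ∀ u, G.Adj v u → u ∈ A → σ u = f u := by
    intro v
    by_cases hv : v ∈ A
    swap
    · exact ⟨id, fun h => absurd h hv⟩
    have hcard : Fintype.card (G.neighborSet v) = (G.neighborFinset (f v)).card := by
      rw [G.card_neighborSet_eq_degree, G.card_neighborFinset_eq_degree, hreg, hreg]
    obtain ⟨e, he⟩ := Set.MapsTo.exists_equiv_extend_of_card_eq (α := G.neighborSet v) hcard
      (s := {u | (u : V) ∈ A}) (f := fun u => f u)
      (fun u hu => by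
        rw [Finset.mem_coe, SimpleGraph.mem_neighborFinset]
        exact hf.adj hv hu u.2)
      (fun u hu w hw huw => Subtype.ext (hf.injOn hG.connected hu hw huw))
    let σ : V → V := fun u => if hu : u ∈ G.neighborSet v then e ⟨u, hu⟩ else u
    have hσ : ∀ (u : V) (hu : u ∈ G.neighborSet v), σ u = e ⟨u, hu⟩ := fun u hu => dif_pos hu
    refine ⟨σ, fun _ => ⟨?_, ?_, ?_⟩⟩
    · intro u hu
      rw [hσ u hu, ← SimpleGraph.mem_neighborFinset]
      exact (e ⟨u, hu⟩).2
    · intro u w hu hw huw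
      rw [hσ u hu, hσ w hw] at huw
      exact congrArg Subtype.val (e.injective (Subtype.ext huw))
    · intro u hu huA
      rw [hσ u hu]
      exact he ⟨u, hu⟩ huA
  choose σ hσ using hσ
  -- The new vertices are leaves of `B`: a neighbour farther from both points of the centre would
  -- lie outside `B`.
  have hout : ∀ u ∈ B, u ∉ A → ∀ v ∈ B, G.Adj u v → v = p u := by
    intro u hu huA v hv huv
    obtain ⟨h1, h2, h3, h4⟩ := hp u hu huA
    rw [hB, mem_fullSet] at hu hv
    rw [hA, mem_fullSet] at huA
    by_contra hne
    rcases hG.dist_eq_dist_add_one_of_adj x huv with h5 | h5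
    · exact hne (adj_eq_of_dist_eq hG huv h1 h5 h3)
    · rcases hG.dist_eq_dist_add_one_of_adj y huv with h6 | h6
      · exact hne (adj_eq_of_dist_eq hG huv h1 h6 h4)
      · omega
  let g : V → V := fun u => if u ∈ A then f u else σ (p u) u
  have hgA : ∀ u ∈ A, g u = f u := fun u hu => if_pos hu
  have hgσ : ∀ v ∈ A, ∀ u ∈ B, G.Adj v u → g u = σ v u := by
    intro v hv u hu hvu
    by_cases huA : u ∈ A
    · rw [hgA u huA, (hσ v hv).2.2 u hvu huA]
    · rw [hout u hu huA v (hAB hv) hvu.symm]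
      exact if_neg huA
  refine ⟨g, hgA, isometricOn_of_locallyInjective hG (geodConvex_fullSet hG _ _ _) ?_ ?_⟩
  · intro u hu v hv huv
    by_cases huA : u ∈ A
    · rw [hgA u huA, hgσ u huA v hv huv]
      exact (hσ u huA).1 v huv
    · have hvA : v ∈ A := by rw [hout u hu huA v hv huv]; exact (hp u hu huA).2.1
      rw [hgA v hvA, hgσ v hvA u hu huv.symm]
      exact ((hσ v hvA).1 u huv.symm).symm
  · intro v hv u hu w hw hvu hvw huw
    by_cases hvA : v ∈ A
    · rw [hgσ v hvA u hu hvu, hgσ v hvA w hw hvw] at huw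
      exact (hσ v hvA).2.1 u w hvu hvw huw
    · rw [hout v hv hvA u hu hvu, hout v hv hvA w hw hvw]

/-- Any two balls of the same diameter are isometric. -/
theorem exists_isometricOn (hG : G.IsTree) {q : ℕ} [G.LocallyFinite]
    (hreg : G.IsRegularOfDegree (q + 1)) {j : ℕ} {x y x' y' : V} (h : IsCenter G j x y)
    (h' : IsCenter G j x' y') :
    ∃ f : V → V, f x = x' ∧ f y = y' ∧ IsometricOn G f (fullSet G j x y) := by
  classical
  induction j using Nat.twoStepInduction with
  | zero =>
    rcases h with ⟨-, rfl⟩ | ⟨h, -⟩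
    · rcases h' with ⟨-, rfl⟩ | ⟨h', -⟩
      · refine ⟨fun _ => x', rfl, rfl, fun u hu v hv => ?_⟩
        rw [mem_fullSet] at hu hv
        have h1 := (hG.connected.dist_eq_zero_iff).1 (show G.dist x u = 0 by omega)
        have h2 := (hG.connected.dist_eq_zero_iff).1 (show G.dist x v = 0 by omega)
        simp [← h1, ← h2]
      · simp at h'
    · simp at h
  | one =>
    rcases h with ⟨h, -⟩ | ⟨-, h⟩
    · simp at h
    rcases h' with ⟨h', -⟩ | ⟨-, h'⟩
    · simp at h'
    have hmem : ∀ u ∈ fullSet G 1 x y, u = x ∨ u = y := by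
      intro u hu
      rw [mem_fullSet] at hu
      by_cases hx : G.dist x u = 0
      · exact Or.inl ((hG.connected.dist_eq_zero_iff).1 hx).symm
      · exact Or.inr ((hG.connected.dist_eq_zero_iff).1 (show G.dist y u = 0 by omega)).symm
    have e1 := SimpleGraph.dist_eq_one_iff_adj.2 h
    have e2 := SimpleGraph.dist_eq_one_iff_adj.2 h.symm
    have e3 := SimpleGraph.dist_eq_one_iff_adj.2 h'
    have e4 := SimpleGraph.dist_eq_one_iff_adj.2 h'.symm
    have hfy : (if y = x then x' else y') = y' := if_neg h.ne'
    refine ⟨fun u => if u = x then x' else y', if_pos rfl, hfy, fun u hu v hv => ?_⟩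
    rcases hmem u hu with rfl | rfl <;> rcases hmem v hv with rfl | rfl <;>
      simp [hfy, e1, e2, e3, e4]
  | more j ih _ =>
    rw [IsCenter.add_two_iff] at h h'
    obtain ⟨f, hx, hy, hf⟩ := ih h h'
    obtain ⟨g, hgf, hg⟩ := exists_isometricOn_add_two hG hreg h hf
    exact ⟨g, by rw [hgf h.left_mem, hx], by rw [hgf h.right_mem, hy], hg⟩

theorem IsometricOn.mapsTo_fullSet {j : ℕ} {x y : V} (h : IsCenter G j x y) {f : V → V}
    (hf : IsometricOn G f (fullSet G j x y)) :
    Set.MapsTo f (fullSet G j x y) (fullSet G j (f x) (f y)) := by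
  intro v hv
  rw [mem_fullSet, hf _ h.left_mem _ hv, hf _ h.right_mem _ hv]
  exact hv

theorem IsCenter.map {j l : ℕ} {x y : V} (h : IsCenter G j x y) {f : V → V}
    (hf : IsometricOn G f (fullSet G l x y)) (hj : IsCenter G l x y) : IsCenter G j (f x) (f y) := by
  rcases h with ⟨h1, rfl⟩ | ⟨h1, h2⟩
  · exact Or.inl ⟨h1, rfl⟩
  · exact Or.inr ⟨h1, hf.adj hj.left_mem hj.right_mem h2⟩

theorem ncard_fullSet_eq (hG : G.IsTree) {q : ℕ} [G.LocallyFinite]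
    (hreg : G.IsRegularOfDegree (q + 1)) {j : ℕ} {x y x' y' : V} (h : IsCenter G j x y)
    (h' : IsCenter G j x' y') : (fullSet G j x y).ncard = (fullSet G j x' y').ncard := by
  have key : ∀ {x y x' y' : V}, IsCenter G j x y → IsCenter G j x' y' →
      (fullSet G j x y).ncard ≤ (fullSet G j x' y').ncard := by
    intro x y x' y' h h'
    obtain ⟨f, hx, hy, hf⟩ := exists_isometricOn hG hreg h h'
    have hmaps := hf.mapsTo_fullSet h
    rw [hx, hy] at hmaps
    exact Set.ncard_le_ncard_of_injOn f hmaps (hf.injOn hG.connected)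
      (IsFullSet.finite hG.connected ⟨x', y', h', rfl⟩)
  exact le_antisymm (key h h') (key h' h)

/-- An isometric map carries balls onto balls. -/
theorem IsometricOn.image_fullSet (hG : G.IsTree) {q : ℕ} [G.LocallyFinite]
    (hreg : G.IsRegularOfDegree (q + 1)) {j : ℕ} {x y : V} (h : IsCenter G j x y) {f : V → V}
    (hf : IsometricOn G f (fullSet G j x y)) :
    f '' fullSet G j x y = fullSet G j (f x) (f y) := by
  have h' : IsCenter G j (f x) (f y) := h.map hf h
  refine Set.eq_of_subset_of_ncard_le (hf.mapsTo_fullSet h).image_subset ?_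
    (IsFullSet.finite hG.connected ⟨_, _, h', rfl⟩)
  rw [(hf.injOn hG.connected).ncard_image, ncard_fullSet_eq hG hreg h h']

theorem IsFullSet.image (hG : G.IsTree) {q : ℕ} [G.LocallyFinite]
    (hreg : G.IsRegularOfDegree (q + 1)) {j : ℕ} {A : Set V} (hA : IsFullSet G j A) {f : V → V}
    (hf : IsometricOn G f A) : IsFullSet G j (f '' A) := by
  obtain ⟨x, y, h, rfl⟩ := hA
  exact ⟨f x, f y, h.map hf h, hf.image_fullSet hG hreg h⟩

theorem IsFullSet.exists_isometricOn (hG : G.IsTree) {q : ℕ} [G.LocallyFinite]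
    (hreg : G.IsRegularOfDegree (q + 1)) {j : ℕ} {A B : Set V} (hA : IsFullSet G j A)
    (hB : IsFullSet G j B) : ∃ f : V → V, IsometricOn G f A ∧ f '' A = B := by
  obtain ⟨x, y, h, rfl⟩ := hA
  obtain ⟨x', y', h', rfl⟩ := hB
  obtain ⟨f, rfl, rfl, hf⟩ := BetheExtension.exists_isometricOn hG hreg h h'
  exact ⟨f, hf, hf.image_fullSet hG hreg h⟩

/-- The balls of diameter `j` contained in `S`. -/
def subFull (G : SimpleGraph V) (j : ℕ) (S : Set V) : Set (Set V) :=
  {C | IsFullSet G j C ∧ C ⊆ S}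

/-- The points of the ball of diameter `j - 1`, empty for `j = 0`. -/
def coreSet (G : SimpleGraph V) (j : ℕ) (x y : V) : Set V :=
  {v | G.dist x v + G.dist y v + 1 ≤ j}

theorem mem_coreSet {j : ℕ} {x y v : V} :
    v ∈ coreSet G j x y ↔ G.dist x v + G.dist y v + 1 ≤ j := Iff.rfl

theorem coreSet_zero (x y : V) : coreSet G 0 x y = ∅ := by ext v; simp [coreSet]

theorem coreSet_succ (j : ℕ) (x y : V) : coreSet G (j + 1) x y = fullSet G j x y := by
  ext v; simp [coreSet, fullSet]

section Vertex

variable {j : ℕ} {x : V}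

/-- Prolonging the geodesic from `x` through the central edge of `C` reaches a point of `C` at
distance `(dist a x + dist b x + j) / 2` from `x`. This is at most `(j + 1) / 2`, so `x` is an end
of that edge. -/
theorem subFull_vertex (hG : G.IsTree) {q : ℕ} (hq : 1 ≤ q) [G.LocallyFinite]
    (hreg : G.IsRegularOfDegree (q + 1)) (hj : Odd j) (x : V) :
    subFull G j (fullSet G (j + 1) x x) = (fun y => fullSet G j x y) '' G.neighborSet x := by
  ext C
  constructor
  · rintro ⟨⟨a, b, ⟨he, -⟩ | ⟨-, hab⟩, rfl⟩, hC⟩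
    · exact absurd hj (Nat.not_odd_iff_even.2 he)
    · obtain ⟨u, hu, hxu⟩ := exists_prolongation hG hq hreg (Or.inr ⟨hj, hab⟩) x
      have hu' := hC (show u ∈ fullSet G j a b from hu.le)
      rw [mem_fullSet] at hu'
      by_cases ha : G.dist a x = 0
      · obtain rfl := (hG.connected.dist_eq_zero_iff).1 ha
        exact ⟨b, hab, rfl⟩
      · obtain rfl := (hG.connected.dist_eq_zero_iff).1 (show G.dist b x = 0 by omega)
        exact ⟨a, hab.symm, fullSet_comm _ _ _⟩
  · rintro ⟨y, hy, rfl⟩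
    refine ⟨⟨x, y, Or.inr ⟨hj, hy⟩, rfl⟩, fun v hv => ?_⟩
    have hy' : G.Adj x y := hy
    have := hG.dist_eq_dist_add_one_of_adj v hy'
    simp only [G.dist_comm (u := v)] at this
    simp only [mem_fullSet] at hv ⊢
    obtain ⟨m, rfl⟩ := hj
    omega

theorem injOn_fullSet_vertex (hG : G.IsTree) {q : ℕ} (hq : 1 ≤ q) [G.LocallyFinite]
    (hreg : G.IsRegularOfDegree (q + 1)) (hj : Odd j) (x : V) :
    Set.InjOn (fun y => fullSet G j x y) (G.neighborSet x) := by
  intro y hy y' hy' heq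
  by_contra hne
  have hy1 : G.Adj x y := hy
  have hy2 : G.Adj x y' := hy'
  obtain ⟨u, hu, hyu⟩ := exists_prolongation hG hq hreg (Or.inr ⟨hj, hy1⟩) y'
  have hu' : u ∈ fullSet G j x y' := by
    have : u ∈ fullSet G j x y := hu.le
    simpa only [heq] using this
  rw [mem_fullSet] at hu'
  have e1 := SimpleGraph.dist_eq_one_iff_adj.2 hy1
  have e2 := SimpleGraph.dist_eq_one_iff_adj.2 hy2
  have e3 : G.dist y x = 1 := by rw [G.dist_comm, e1]
  have t := hy2.diff_dist_adj (u := u)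
  simp only [G.dist_comm (u := u)] at t
  rcases hG.dist_eq_dist_add_one_of_adj y hy2 with h1 | h1
  · have : G.dist y y' = 0 := by omega
    exact hne ((hG.connected.dist_eq_zero_iff).1 this)
  · omega

/-- No `v` is closer to both `y` and `y'` than to `x`, so one of the two conditions reads `2 * dist
x v + 1 ≤ j`; the other is no stronger. -/
theorem inter_fullSet_vertex (hG : G.IsTree) (hj : Odd j) {y y' : V}
    (hy : G.Adj x y) (hy' : G.Adj x y') (hne : y ≠ y') :
    fullSet G j x y ∩ fullSet G j x y' = coreSet G j x x := by
  ext v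
  have t := hG.dist_eq_dist_add_one_of_adj v hy
  have t' := hG.dist_eq_dist_add_one_of_adj v hy'
  obtain ⟨m, rfl⟩ := hj
  have hn : ¬ (G.dist v x = G.dist v y + 1 ∧ G.dist v x = G.dist v y' + 1) := fun h =>
    hne (adj_eq_of_dist_eq hG hy hy' h.1 h.2)
  simp only [G.dist_comm (u := v)] at t t' hn
  simp only [Set.mem_inter_iff, mem_fullSet, mem_coreSet]
  omega

theorem exists_adj_of_regular {q : ℕ} (hq : 1 ≤ q) [G.LocallyFinite]
    (hreg : G.IsRegularOfDegree (q + 1)) (x : V) : ∃ y, G.Adj x y := by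
  have : (G.neighborFinset x).Nonempty := by
    rw [← Finset.card_pos, G.card_neighborFinset_eq_degree, hreg]; omega
  obtain ⟨y, hy⟩ := this
  exact ⟨y, by rwa [SimpleGraph.mem_neighborFinset] at hy⟩

theorem sUnion_fullSet_vertex (hG : G.IsTree) {q : ℕ} (hq : 1 ≤ q) [G.LocallyFinite]
    (hreg : G.IsRegularOfDegree (q + 1)) (hj : Odd j) (x : V) {v : V}
    (hv : v ∈ fullSet G (j + 1) x x) : ∃ y, G.Adj x y ∧ v ∈ fullSet G j x y := by
  by_cases hxv : x = v
  · subst hxv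
    obtain ⟨y, hy⟩ := exists_adj_of_regular hq hreg x
    exact ⟨y, hy, IsCenter.left_mem (Or.inr ⟨hj, hy⟩)⟩
  · obtain ⟨y, hy, h⟩ := exists_adj_dist_eq hG.connected hxv
    refine ⟨y, hy, ?_⟩
    rw [G.dist_comm, G.dist_comm (v := y)] at h
    rw [mem_fullSet] at hv ⊢
    omega

end Vertex

section Edge

variable {j : ℕ} {x y : V}

/-- The geodesic from the end of the edge farther from `a`, prolonged through `a` by `j / 2`, leaves
the large ball unless `a` is the nearer end. -/
theorem subFull_edge (hG : G.IsTree) {q : ℕ} (hq : 1 ≤ q) [G.LocallyFinite]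
    (hreg : G.IsRegularOfDegree (q + 1)) (hj : Even j) (h : G.Adj x y) :
    subFull G j (fullSet G (j + 1) x y) = {fullSet G j x x, fullSet G j y y} := by
  ext C
  constructor
  · rintro ⟨⟨a, b, ⟨-, rfl⟩ | ⟨ho, -⟩, rfl⟩, hC⟩
    · have key : ∀ {x y : V}, G.Adj x y → fullSet G j a a ⊆ fullSet G (j + 1) x y →
          G.dist a y = G.dist a x + 1 → x = a := by
        intro x y h hC hd
        obtain ⟨u, hu, hyu⟩ := exists_prolongation hG hq hreg (Or.inl ⟨hj, rfl⟩ : IsCenter G j a a) y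
        have hu' := hC (show u ∈ fullSet G j a a from hu.le)
        rw [mem_fullSet] at hu'
        have t := hG.dist_eq_dist_add_one_of_adj u h
        simp only [G.dist_comm (u := u)] at t
        have : G.dist x a = 0 := by
          rw [G.dist_comm]; omega
        exact (hG.connected.dist_eq_zero_iff).1 this
      rcases hG.dist_eq_dist_add_one_of_adj a h with h1 | h1
      · right; rw [key h.symm (by rwa [fullSet_comm _ y x]) h1]; rfl
      · left; rw [key h hC h1]
    · exact absurd ho (Nat.not_odd_iff_even.2 hj)
  · have h1 : ∀ v, G.dist x v = G.dist y v + 1 ∨ G.dist y v = G.dist x v + 1 := by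
      intro v
      have := hG.dist_eq_dist_add_one_of_adj v h
      simpa only [G.dist_comm (u := v)] using this
    rintro (rfl | rfl)
    · refine ⟨⟨x, x, Or.inl ⟨hj, rfl⟩, rfl⟩, fun v hv => ?_⟩
      have := h1 v
      rw [mem_fullSet] at hv ⊢
      omega
    · refine ⟨⟨y, y, Or.inl ⟨hj, rfl⟩, rfl⟩, fun v hv => ?_⟩
      have := h1 v
      rw [mem_fullSet] at hv ⊢
      omega

theorem fullSet_ne_of_adj (hG : G.IsTree) {q : ℕ} (hq : 1 ≤ q) [G.LocallyFinite]
    (hreg : G.IsRegularOfDegree (q + 1)) (hj : Even j) (h : G.Adj x y) :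
    fullSet G j x x ≠ fullSet G j y y := by
  intro heq
  obtain ⟨u, hu, hyu⟩ := exists_prolongation hG hq hreg (Or.inl ⟨hj, rfl⟩ : IsCenter G j x x) y
  have hu' : u ∈ fullSet G j y y := by
    rw [← heq]; exact hu.le
  have e1 := SimpleGraph.dist_eq_one_iff_adj.2 h
  rw [mem_fullSet] at hu'
  omega

theorem inter_fullSet_edge (hG : G.IsTree) (hj : Even j) (h : G.Adj x y) :
    fullSet G j x x ∩ fullSet G j y y = coreSet G j x y := by
  ext v
  have t := hG.dist_eq_dist_add_one_of_adj v h
  obtain ⟨m, rfl⟩ := hj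
  simp only [G.dist_comm (u := v)] at t
  simp only [Set.mem_inter_iff, mem_fullSet, mem_coreSet]
  omega

end Edge

/-- The combinatorics of the balls of diameter `j` in a ball of diameter `j + 1`. -/
structure IsSunflower (G : SimpleGraph V) (q j : ℕ) (S D : Set V) : Prop where
  finite : (subFull G j S).Finite
  ncard : (subFull G j S).ncard = numCopies q j
  pairwise : (subFull G j S).Pairwise fun C C' => C ∩ C' = D
  subset : ∀ C ∈ subFull G j S, D ⊆ C
  cover : ∀ v ∈ S, ∃ C ∈ subFull G j S, v ∈ C

theorem isSunflower_coreSet (hG : G.IsTree) {q : ℕ} (hq : 1 ≤ q) [G.LocallyFinite]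
    (hreg : G.IsRegularOfDegree (q + 1)) {j : ℕ} {x y : V} (h : IsCenter G (j + 1) x y) :
    IsSunflower G q j (fullSet G (j + 1) x y) (coreSet G j x y) := by
  rcases h with ⟨hj, rfl⟩ | ⟨hj, h⟩
  · replace hj : Odd j := by
      rcases Nat.even_or_odd j with h | h
      · exact absurd hj (by simp [parity_simps, h])
      · exact h
    have e := subFull_vertex hG hq hreg hj x
    refine ⟨?_, ?_, ?_, ?_, ?_⟩
    · rw [e]; exact (Set.toFinite _).image _
    · rw [e, (injOn_fullSet_vertex hG hq hreg hj x).ncard_image, Set.ncard_eq_toFinset_card',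
        Set.toFinset_card, G.card_neighborSet_eq_degree, hreg, numCopies,
        if_neg (Nat.not_even_iff_odd.2 hj)]
    · rw [e]
      rintro _ ⟨y, hy, rfl⟩ _ ⟨y', hy', rfl⟩ hne
      exact inter_fullSet_vertex hG hj hy hy' fun h => hne (by rw [h])
    · rw [e]
      rintro _ ⟨y, hy, rfl⟩ v hv
      have t := SimpleGraph.Adj.diff_dist_adj (G := G) (u := v) hy
      simp only [G.dist_comm (u := v)] at t
      simp only [mem_coreSet] at hv
      rw [mem_fullSet]
      obtain ⟨m, rfl⟩ := hj
      omega
    · intro v hv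
      obtain ⟨y, hy, hvy⟩ := sUnion_fullSet_vertex hG hq hreg hj x hv
      exact ⟨_, by rw [e]; exact ⟨y, hy, rfl⟩, hvy⟩
  · replace hj : Even j := by
      rcases Nat.even_or_odd j with h | h
      · exact h
      · exact absurd hj (by simp [parity_simps, h])
    have e := subFull_edge hG hq hreg hj h
    have hi := inter_fullSet_edge hG hj h
    refine ⟨?_, ?_, ?_, ?_, ?_⟩
    · rw [e]; exact Set.toFinite _
    · rw [e, Set.ncard_pair (fullSet_ne_of_adj hG hq hreg hj h), numCopies, if_pos hj]
    · rw [e]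
      rintro _ (rfl | rfl) _ (rfl | rfl) hne
      · exact absurd rfl hne
      · exact hi
      · rw [← hi, Set.inter_comm]
      · exact absurd rfl hne
    · rw [e, ← hi]
      rintro _ (rfl | rfl)
      · exact Set.inter_subset_left
      · exact Set.inter_subset_right
    · rw [e]
      intro v hv
      rw [mem_fullSet] at hv
      rcases hG.dist_eq_dist_add_one_of_adj v h with t | t <;>
        simp only [G.dist_comm (u := v)] at t
      · exact ⟨fullSet G j y y, Or.inr rfl, by rw [mem_fullSet]; omega⟩
      · exact ⟨fullSet G j x x, Or.inl rfl, by rw [mem_fullSet]; omega⟩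

end FullSets

/-! ### Full subgraphs are the induced subgraphs on balls -/

section FullSubgraphs

variable {V : Type*} {G : SimpleGraph V}

/-- A connected subgraph of a tree is isometrically embedded. -/
theorem dist_coe_eq (hG : G.IsTree) {H : G.Subgraph} (hH : H.coe.Preconnected) (u v : H.verts) :
    H.coe.dist u v = G.dist u v := by
  obtain ⟨p, hp, hpl⟩ := (hH u v).exists_path_of_dist
  obtain ⟨p', hp', hpl'⟩ := hG.connected.exists_path_of_dist (u : V) (v : V)
  have h := (hG.existsUnique_path (u : V) (v : V)).unique
    (SimpleGraph.Walk.IsPath.map (f := H.hom) H.hom_injective hp) hp'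
  have h2 := congrArg SimpleGraph.Walk.length h
  rw [SimpleGraph.Walk.length_map] at h2
  exact hpl.symm.trans (h2.trans hpl')

theorem edist_coe_eq (hG : G.IsTree) {H : G.Subgraph} (hH : H.coe.Preconnected) (u v : H.verts) :
    H.coe.edist u v = (G.dist u v : ℕ∞) := by
  rw [← (hH u v).coe_dist_eq_edist, dist_coe_eq hG hH]

/-- The induced subgraph on a set of vertices. -/
abbrev indSub (G : SimpleGraph V) (A : Set V) : G.Subgraph := (⊤ : G.Subgraph).induce A

theorem indSub_coe_adj {A : Set V} {u v : (indSub G A).verts} :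
    (indSub G A).coe.Adj u v ↔ G.Adj u v := by
  have hu : (u : V) ∈ A := u.2
  have hv : (v : V) ∈ A := v.2
  simp [hu, hv]

theorem le_indSub {H : G.Subgraph} {A : Set V} (h : H.verts ⊆ A) : H ≤ indSub G A := by
  refine ⟨h, fun u v huv => ?_⟩
  rw [SimpleGraph.Subgraph.induce_adj, SimpleGraph.Subgraph.top_adj]
  exact ⟨h huv.fst_mem, h huv.snd_mem, huv.adj_sub⟩

theorem indSub_mono_iff {A B : Set V} : indSub G A ≤ indSub G B ↔ A ⊆ B :=
  ⟨fun h => h.1, fun h => le_indSub h⟩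

theorem GeodConvex.preconnected (hG : G.Connected) {A : Set V} (hA : GeodConvex G A) :
    (indSub G A).coe.Preconnected := by
  intro u v
  induction hn : G.dist u v generalizing v with
  | zero =>
    rw [Subtype.ext ((hG.dist_eq_zero_iff).1 hn)]
  | succ n ih =>
    have hne : (v : V) ≠ u := by
      intro h; rw [h, SimpleGraph.dist_self] at hn; omega
    obtain ⟨w, hvw, hw⟩ := exists_adj_dist_eq hG hne
    have hwA : w ∈ A := hA u u.2 v v.2 w hvw hw
    refine (ih ⟨w, hwA⟩ (by change G.dist u w = n; omega)).trans ?_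
    exact SimpleGraph.Adj.reachable (indSub_coe_adj.2 hvw.symm)

theorem ediam_le_iff (hG : G.IsTree) {H : G.Subgraph} {j : ℕ} (hH : H.coe.Preconnected) :
    H.coe.ediam ≤ j ↔ ∀ u ∈ H.verts, ∀ v ∈ H.verts, G.dist u v ≤ j := by
  rw [SimpleGraph.ediam_le_iff]
  constructor
  · intro h u hu v hv
    have := h ⟨u, hu⟩ ⟨v, hv⟩
    rw [edist_coe_eq hG hH] at this
    exact_mod_cast this
  · intro h u v
    rw [edist_coe_eq hG hH]
    exact_mod_cast h u u.2 v v.2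

theorem dist_le_of_mem_fullSet (hG : G.Connected) {j : ℕ} {x y u v : V} (hu : u ∈ fullSet G j x y)
    (hv : v ∈ fullSet G j x y) : G.dist u v ≤ j := by
  rw [mem_fullSet] at hu hv
  have t1 := hG.dist_triangle (u := u) (v := x) (w := v)
  have t2 := hG.dist_triangle (u := u) (v := y) (w := v)
  rw [G.dist_comm (u := u) (v := x)] at t1
  rw [G.dist_comm (u := u) (v := y)] at t2
  omega

theorem ediam_fullSet (hG : G.IsTree) {q : ℕ} (hq : 1 ≤ q) [G.LocallyFinite]
    (hreg : G.IsRegularOfDegree (q + 1)) {j : ℕ} {x y : V} (h : IsCenter G j x y) :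
    (indSub G (fullSet G j x y)).coe.ediam = j := by
  have hc := (geodConvex_fullSet hG j x y).preconnected hG.connected
  refine le_antisymm ((ediam_le_iff hG hc).2 fun u hu v hv =>
    dist_le_of_mem_fullSet hG.connected hu hv) ?_
  -- A boundary point `u` and its prolongation `v` through the centre are at distance exactly `j`.
  obtain ⟨u, hu, -⟩ := exists_prolongation hG hq hreg h x
  obtain ⟨v, hv, huv⟩ := exists_prolongation hG hq hreg h u
  have h1 := SimpleGraph.edist_le_ediam (G := (indSub G (fullSet G j x y)).coe)
    (u := ⟨u, hu.le⟩) (v := ⟨v, hv.le⟩)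
  rw [edist_coe_eq hG hc] at h1
  have h2 : G.dist u v = j := by omega
  rw [h2] at h1
  exact h1

/-- The points at distance at most `j` from both ends of a geodesic of length `j` lie in the
ball of diameter `j` about its midpoint. -/
theorem exists_center (hG : G.IsTree) {j : ℕ} {u v : V} (huv : G.dist u v = j) :
    ∃ x y, IsCenter G j x y ∧
      ∀ w, G.dist x w + G.dist y w + j ≤ 2 * max (G.dist u w) (G.dist v w) := by
  induction j using Nat.twoStepInduction generalizing u v with
  | zero =>
    obtain rfl := (hG.connected.dist_eq_zero_iff).1 huv
    exact ⟨u, u, Or.inl ⟨by simp, rfl⟩, fun w => by omega⟩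
  | one =>
    have h := SimpleGraph.dist_eq_one_iff_adj.1 huv
    refine ⟨u, v, Or.inr ⟨by simp, h⟩, fun w => ?_⟩
    have := hG.dist_eq_dist_add_one_of_adj w h
    simp only [G.dist_comm (u := w)] at this
    omega
  | more j ih _ =>
    have hne : u ≠ v := by rintro rfl; simp at huv
    obtain ⟨u', huu', hu'⟩ := exists_adj_dist_eq hG.connected hne
    have hne' : v ≠ u' := by
      rintro rfl
      rw [SimpleGraph.dist_self, G.dist_comm] at hu'
      omega
    obtain ⟨v', hvv', hv'⟩ := exists_adj_dist_eq hG.connected hne'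
    have e1 : G.dist v u = G.dist u v := G.dist_comm
    have e2 : G.dist v u' = G.dist u' v := G.dist_comm
    obtain ⟨x, y, h, hw⟩ := ih (u := u') (v := v') (by omega)
    refine ⟨x, y, IsCenter.add_two_iff.2 h, fun w => ?_⟩
    have t := hw w
    have huv' : G.dist u v = G.dist u v' + 1 := by
      have := hG.connected.dist_triangle (u := u) (v := u') (w := v')
      rw [SimpleGraph.dist_eq_one_iff_adj.2 huu'] at this
      have := hvv'.diff_dist_adj (u := u)
      omega
    -- It suffices that the maximum of the distances from `w` to the ends grows by one when the
    -- shortened geodesic is restored. If one end comes closer to `w`, the geodesic from `w` to the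
    -- other end runs along the restored one, so that end attains the maximum.
    rcases hG.dist_eq_dist_add_one_of_adj w huu' with h1 | h1 <;>
      rcases hG.dist_eq_dist_add_one_of_adj w hvv' with h2 | h2
    · simp only [G.dist_comm (u := w)] at h1 h2; omega
    · have h3 := dist_eq_add_of_adj hG hvv' h2 (v := u) (by rw [e1, huv', G.dist_comm])
      have h4 := dist_eq_add_of_adj hG hvv' h2 (v := u') (by rw [e2, hv', G.dist_comm])
      rw [G.dist_comm (u := v')] at h3 h4
      simp only [G.dist_comm (u := w)] at h1 h2 h3 h4
      omega
    · have h3 := dist_eq_add_of_adj hG huu' h1 (v := v) (by rw [← e1, hu', e2])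
      have h4 := dist_eq_add_of_adj hG huu' h1 (v := v') (by
        have := hG.connected.dist_triangle (u := u) (v := u') (w := v')
        rw [SimpleGraph.dist_eq_one_iff_adj.2 huu'] at this
        omega)
      simp only [G.dist_comm (u := w)] at h1 h2 h3 h4
      omega
    · have h3 := dist_eq_add_of_adj hG huu' h1 (v := v) (by rw [← e1, hu', e2])
      have h4 := hG.connected.dist_triangle (u := w) (v := u') (w := v')
      omega

theorem exists_subset_fullSet (hG : G.IsTree) {H : G.Subgraph} {j : ℕ}
    (hH : H.coe.ediam = (j : ℕ∞)) : ∃ x y, IsCenter G j x y ∧ H.verts ⊆ fullSet G j x y := by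
  have htop : H.coe.ediam ≠ ⊤ := by rw [hH]; exact ENat.natCast_ne_top j
  have hc := SimpleGraph.preconnected_of_ediam_ne_top htop
  have hle := (ediam_le_iff hG hc).1 hH.le
  -- The empty subgraph also has diameter 0, and lies in any ball of diameter 0.
  rcases isEmpty_or_nonempty H.verts with he | hne
  · have : Subsingleton H.verts := inferInstance
    rw [SimpleGraph.ediam_eq_zero_of_subsingleton] at hH
    obtain rfl : j = 0 := by exact_mod_cast hH.symm
    obtain ⟨x⟩ := hG.connected.nonempty
    exact ⟨x, x, Or.inl ⟨by simp, rfl⟩, fun v hv => (he.false ⟨v, hv⟩).elim⟩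
  · obtain ⟨u, v, huv⟩ := SimpleGraph.exists_edist_eq_ediam_of_ne_top htop
    rw [hH, edist_coe_eq hG hc] at huv
    obtain ⟨x, y, h, hw⟩ := exists_center hG (j := j) (u := (u : V)) (v := (v : V))
      (by exact_mod_cast huv)
    refine ⟨x, y, h, fun w hwH => ?_⟩
    have t := hw w
    have t1 := hle u u.2 w hwH
    have t2 := hle v v.2 w hwH
    rw [mem_fullSet]
    omega

/-- The full subgraphs of diameter `j` are the induced subgraphs on the balls of diameter `j`. -/
theorem isFull_iff (hG : G.IsTree) {q : ℕ} (hq : 1 ≤ q) [G.LocallyFinite]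
    (hreg : G.IsRegularOfDegree (q + 1)) {j : ℕ} {H : G.Subgraph} :
    IsFull j H ↔ ∃ A, IsFullSet G j A ∧ H = indSub G A := by
  constructor
  · intro hH
    obtain ⟨x, y, h, hsub⟩ := exists_subset_fullSet hG hH.1
    exact ⟨_, ⟨x, y, h, rfl⟩, le_antisymm (le_indSub hsub)
      (hH.2 (ediam_fullSet hG hq hreg h) (le_indSub hsub))⟩
  · rintro ⟨_, ⟨x, y, h, rfl⟩, rfl⟩
    refine ⟨ediam_fullSet hG hq hreg h, fun K hK hle => le_indSub fun w hw => ?_⟩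
    have htop : K.coe.ediam ≠ ⊤ := by
      rw [show K.coe.ediam = (j : ℕ∞) from hK]; exact ENat.natCast_ne_top j
    have hc := SimpleGraph.preconnected_of_ediam_ne_top htop
    have hd := (ediam_le_iff hG hc).1 (show K.coe.ediam ≤ j from hK.le)
    -- The ball contains a point `u` at distance `(dist x w + dist y w + j) / 2` from `w`. Since
    -- this is at most `j`, already `w` lies in the ball.
    obtain ⟨u, hu, hwu⟩ := exists_prolongation hG hq hreg h w
    have := hd w hw u (hle.1 hu.le)
    rw [mem_fullSet]
    omega

theorem isFull_indSub_iff (hG : G.IsTree) {q : ℕ} (hq : 1 ≤ q) [G.LocallyFinite]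
    (hreg : G.IsRegularOfDegree (q + 1)) {j : ℕ} {A : Set V} :
    IsFull j (indSub G A) ↔ IsFullSet G j A := by
  rw [isFull_iff hG hq hreg]
  constructor
  · rintro ⟨B, hB, h⟩
    rwa [show A = B from congrArg SimpleGraph.Subgraph.verts h]
  · exact fun h => ⟨A, h, rfl⟩

/-- Isometric maps restrict to isomorphisms between induced subgraphs. -/
noncomputable def IsometricOn.iso (hG : G.Connected) {A : Set V} {f : V → V} {B : Set V}
    (hf : IsometricOn G f A) (hB : f '' A = B) : (indSub G A).coe ≃g (indSub G B).coe where
  toEquiv := Set.BijOn.equiv f (by subst hB; exact (hf.injOn hG).bijOn_image)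
  map_rel_iff' := by
    intro u v
    rw [indSub_coe_adj, indSub_coe_adj, ← SimpleGraph.dist_eq_one_iff_adj,
      ← SimpleGraph.dist_eq_one_iff_adj]
    exact Iff.of_eq (congrArg (· = 1) (hf u u.2 v v.2))

theorem dist_iso_eq {W W' : Type*} {H : SimpleGraph W} {H' : SimpleGraph W'} (hH : H.Preconnected)
    (φ : H ≃g H') (u v : W) : H'.dist (φ u) (φ v) = H.dist u v := by
  have hr : H'.Reachable (φ u) (φ v) := (hH u v).map φ.toHom
  refine le_antisymm ?_ ?_
  · obtain ⟨p, hp⟩ := (hH u v).exists_walk_length_eq_dist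
    rw [← hp, ← SimpleGraph.Walk.length_map φ.toHom p]
    exact SimpleGraph.dist_le _
  · obtain ⟨p, hp⟩ := hr.exists_walk_length_eq_dist
    rw [← hp, ← SimpleGraph.Walk.length_map φ.symm.toHom p]
    have := SimpleGraph.dist_le (p.map φ.symm.toHom)
    simpa using this

/-- Isomorphisms between connected induced subgraphs of a tree are isometric. -/
theorem exists_isometricOn_of_iso (hG : G.IsTree) {A B : Set V} (hA : GeodConvex G A)
    (hB : GeodConvex G B) (φ : (indSub G A).coe ≃g (indSub G B).coe) :
    ∃ f : V → V, IsometricOn G f A ∧ f '' A = B ∧ ∀ u : (indSub G A).verts, (φ u : V) = f u := by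
  classical
  let f : V → V := fun v => if h : v ∈ (indSub G A).verts then φ ⟨v, h⟩ else v
  have hf : ∀ u : (indSub G A).verts, (φ u : V) = f u := fun u => by simp only [f, dif_pos u.2]
  refine ⟨f, ?_, ?_, hf⟩
  · intro u hu v hv
    have h1 := hf ⟨u, hu⟩
    have h2 := hf ⟨v, hv⟩
    rw [← h1, ← h2, ← dist_coe_eq hG (hB.preconnected hG.connected), dist_iso_eq (hA.preconnected hG.connected) φ,
      dist_coe_eq hG (hA.preconnected hG.connected)]
  · ext w
    constructor
    · rintro ⟨u, hu, rfl⟩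
      have h1 := hf ⟨u, hu⟩
      rw [← h1]
      exact (φ ⟨u, hu⟩).2
    · intro hw
      refine ⟨φ.symm ⟨w, hw⟩, (φ.symm ⟨w, hw⟩).2, ?_⟩
      rw [← hf, RelIso.apply_symm_apply]

end FullSubgraphs

/-! ### Agreement of marginals and conditionally independent gluing -/

section Agreement

variable {V : Type*} {Ω : Type*}

/-- The cylinder of the configurations that coincide with `η` on `A`. -/
def cyl (A : Set V) (η : V → Ω) : Set (V → Ω) := {ξ | ∀ v ∈ A, ξ v = η v}

theorem cyl_anti {A B : Set V} (h : A ⊆ B) (η : V → Ω) : cyl B η ⊆ cyl A η :=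
  fun _ hξ v hv => hξ v (h hv)

theorem cyl_congr {A : Set V} {η ξ : V → Ω} (h : Set.EqOn η ξ A) : cyl A η = cyl A ξ := by
  ext ζ
  exact forall₂_congr fun v hv => by rw [h hv]

/-- The restriction of a configuration to a set of vertices. -/
def restrictTo (A : Set V) (η : V → Ω) : A → Ω := fun v => η v

theorem restrictTo_preimage_singleton (A : Set V) (η : V → Ω) :
    restrictTo A ⁻¹' {restrictTo A η} = cyl A η := by
  ext ξ
  simp [cyl, funext_iff, restrictTo]

/-- Every configuration coincides on `A` with one of the form `η ∘ f`, if `f` is injective there. -/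
theorem exists_comp_eqOn {A : Set V} {f : V → V} (hf : Set.InjOn f A) (ζ : V → Ω) :
    ∃ η : V → Ω, Set.EqOn ζ (η ∘ f) A := by
  classical
  by_cases hV : Nonempty V
  · refine ⟨ζ ∘ Function.invFunOn f A, fun v hv => ?_⟩
    simp only [Function.comp_apply]
    rw [hf.leftInvOn_invFunOn hv]
  · exact ⟨ζ, fun v _ => (hV ⟨v⟩).elim⟩

variable [MeasurableSpace Ω]

theorem measurable_restrictTo (A : Set V) : Measurable (restrictTo A : (V → Ω) → A → Ω) :=
  measurable_pi_lambda _ fun v => measurable_pi_apply (v : V)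

/-- Two measures on the configurations have the same marginal on `A`. -/
def AgreeOn (A : Set V) (P Q : Measure (V → Ω)) : Prop :=
  P.map (restrictTo A) = Q.map (restrictTo A)

theorem measurable_comp_right {W : Type*} (f : V → W) :
    Measurable fun η : W → Ω => η ∘ f :=
  measurable_pi_lambda _ fun v => measurable_pi_apply (f v)

theorem AgreeOn.symm {A : Set V} {P Q : Measure (V → Ω)} (h : AgreeOn A P Q) : AgreeOn A Q P :=
  Eq.symm h

theorem AgreeOn.trans {A : Set V} {P Q R : Measure (V → Ω)} (h : AgreeOn A P Q)
    (h' : AgreeOn A Q R) : AgreeOn A P R :=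
  Eq.trans h h'

theorem AgreeOn.map_comp {A B : Set V} {P Q : Measure (V → Ω)} (h : AgreeOn B P Q) {f : V → V}
    (hf : Set.MapsTo f A B) : AgreeOn A (P.map (· ∘ f)) (Q.map (· ∘ f)) := by
  have hc : ∀ R : Measure (V → Ω), (R.map (· ∘ f)).map (restrictTo A) =
      (R.map (restrictTo B)).map (fun (ξ : B → Ω) (a : A) => ξ ⟨f a, hf a.2⟩) := by
    intro R
    rw [Measure.map_map (measurable_restrictTo A) (measurable_comp_right f),
      Measure.map_map (by fun_prop) (measurable_restrictTo B)]
    rfl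
  rw [AgreeOn, hc, hc, h]

theorem AgreeOn.mono {A B : Set V} {P Q : Measure (V → Ω)} (h : AgreeOn B P Q) (hAB : A ⊆ B) :
    AgreeOn A P Q := by
  have := h.map_comp (f := id) (A := A) hAB
  simpa [Function.comp_def] using this

theorem AgreeOn.univ_eq {A : Set V} {P Q : Measure (V → Ω)} (h : AgreeOn A P Q) :
    P Set.univ = Q Set.univ := by
  have := congrArg (fun R => R Set.univ) h
  simpa [Measure.map_apply (measurable_restrictTo A)] using this

theorem AgreeOn.isProbabilityMeasure {A : Set V} {P Q : Measure (V → Ω)} (h : AgreeOn A P Q)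
    [IsProbabilityMeasure Q] : IsProbabilityMeasure P :=
  ⟨by rw [h.univ_eq, measure_univ]⟩

theorem agreeOn_empty (P Q : Measure (V → Ω)) [IsProbabilityMeasure P] [IsProbabilityMeasure Q] :
    AgreeOn ∅ P Q := by
  ext s hs
  rcases s.eq_empty_or_nonempty with rfl | hne
  · simp
  · obtain rfl : s = Set.univ := Subsingleton.eq_univ_of_nonempty hne
    rw [Measure.map_apply (measurable_restrictTo _) hs,
      Measure.map_apply (measurable_restrictTo _) hs]
    simp

variable [Finite Ω] [DiscreteMeasurableSpace Ω]

theorem measurableSet_cyl {A : Set V} (hA : A.Finite) (η : V → Ω) : MeasurableSet (cyl A η) := by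
  have : cyl A η = ⋂ v ∈ A, (fun ξ : V → Ω => ξ v) ⁻¹' {η v} := by
    ext; simp [cyl]
  rw [this]
  exact MeasurableSet.biInter hA.countable fun v _ =>
    measurable_pi_apply v (measurableSet_singleton _)

theorem AgreeOn.cyl_eq {A : Set V} (hA : A.Finite) {P Q : Measure (V → Ω)} (h : AgreeOn A P Q)
    (η : V → Ω) : P (cyl A η) = Q (cyl A η) := by
  have := hA.to_subtype
  rw [← restrictTo_preimage_singleton, ← Measure.map_apply (measurable_restrictTo A) (measurableSet_singleton _),
    ← Measure.map_apply (measurable_restrictTo A) (measurableSet_singleton _), h]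

theorem agreeOn_of_cyl_eq [Nonempty Ω] {A : Set V} (hA : A.Finite) {P Q : Measure (V → Ω)}
    (h : ∀ η, P (cyl A η) = Q (cyl A η)) : AgreeOn A P Q := by
  have := hA.to_subtype
  refine Measure.ext_of_singleton fun ξ => ?_
  obtain ⟨η, rfl⟩ : ∃ η : V → Ω, restrictTo A η = ξ := by
    classical
    refine ⟨fun v => if hv : v ∈ A then ξ ⟨v, hv⟩ else Classical.arbitrary Ω, ?_⟩
    ext v
    simp [restrictTo]
  rw [Measure.map_apply (measurable_restrictTo A) (measurableSet_singleton _),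
    Measure.map_apply (measurable_restrictTo A) (measurableSet_singleton _), restrictTo_preimage_singleton, h]

theorem map_comp_cyl {A : Set V} (hA : A.Finite) (P : Measure (V → Ω)) (f : V → V) (η : V → Ω) :
    (P.map (· ∘ f)) (cyl A (η ∘ f)) = P (cyl (f '' A) η) := by
  rw [Measure.map_apply (measurable_comp_right f) (measurableSet_cyl hA _)]
  congr 1
  ext ξ
  simp [cyl]

/-- Conditionally independent gluing: measures on sets `C i` with pairwise intersections `D`
that agree on `D` have a common extension under which the `C i` are independent given `D`. -/
theorem exists_amalgamation [Nonempty Ω] {ι : Type*} [Fintype ι] [Nonempty ι] {C : ι → Set V}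
    {D : Set V}
    (hC : ∀ i, (C i).Finite) (hD : ∀ i, D ⊆ C i) (hCD : ∀ i j, i ≠ j → C i ∩ C j = D)
    (P : ι → Measure (V → Ω)) [∀ i, IsProbabilityMeasure (P i)] (δ : Measure (V → Ω))
    (hP : ∀ i, AgreeOn D (P i) δ) :
    ∃ Q : Measure (V → Ω), (∀ i, AgreeOn (C i) Q (P i)) ∧
      ∀ η, Q (cyl (⋃ i, C i) η) = δ (cyl D η) * ∏ i, (P i)[cyl (C i) η | cyl D η] := by
  classical
  obtain ⟨i₀⟩ := ‹Nonempty ι›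
  have hDf : D.Finite := (hC i₀).subset (hD i₀)
  have := hDf.fintype
  have := Fintype.ofFinite Ω
  have hPc : ∀ i η, P i (cyl D η) = δ (cyl D η) := fun i η => (hP i).cyl_eq hDf η
  let ext : (D → Ω) → V → Ω := fun ξ v => if hv : v ∈ D then ξ ⟨v, hv⟩ else Classical.arbitrary Ω
  have hext : ∀ (ξ : D → Ω) (v : D), ext ξ v = ξ v := fun ξ v => dif_pos v.2
  have hidx : ∀ v, ∃ i, v ∈ ⋃ i, C i → v ∈ C i := by
    intro v
    by_cases hv : v ∈ ⋃ i, C i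
    · obtain ⟨i, hi⟩ := Set.mem_iUnion.1 hv
      exact ⟨i, fun _ => hi⟩
    · exact ⟨i₀, fun h => absurd h hv⟩
  choose idx hidx using hidx
  let glue : (ι → V → Ω) → V → Ω := fun ω v => ω (idx v) v
  have hglue : Measurable glue := by fun_prop
  -- Given a configuration `ξ` on `D`, drawn from `δ`, the petals are sampled independently and
  -- `glue` reads each vertex from one petal containing it. Configurations `ξ` of mass zero have
  -- weight zero in `Q`.
  let R : (D → Ω) → Measure (ι → V → Ω) := fun ξ =>
    Measure.pi fun i => (P i)[|cyl D (ext ξ)]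
  let Q : Measure (V → Ω) := ∑ ξ : D → Ω, δ (cyl D (ext ξ)) • (R ξ).map glue
  -- Almost surely all components equal `ξ` on `D`, the only place where petals overlap, so the
  -- choice of `idx` is immaterial.
  have hR : ∀ ξ, δ (cyl D (ext ξ)) ≠ 0 → ∀ B : Set V, B.Finite → B ⊆ ⋃ i, C i → ∀ η,
      R ξ (glue ⁻¹' cyl B η) = ∏ i, (P i)[cyl (B ∩ C i) η | cyl D (ext ξ)] := by
    intro ξ hξ B hB hBC η
    have : ∀ i, IsProbabilityMeasure ((P i)[|cyl D (ext ξ)]) := fun i =>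
      cond_isProbabilityMeasure (by rwa [hPc])
    rw [← Measure.pi_pi]
    refine measure_congr ?_
    have hN : ∀ᵐ ω ∂(R ξ), ∀ i, ω i ∈ cyl D (ext ξ) := by
      rw [ae_all_iff]
      intro i
      have h1 : ∀ᵐ ω ∂((P i)[|cyl D (ext ξ)]), ω ∈ cyl D (ext ξ) :=
        ae_cond_mem (measurableSet_cyl hDf _)
      exact (Measure.quasiMeasurePreserving_eval (fun i => (P i)[|cyl D (ext ξ)]) i).ae h1
    filter_upwards [hN] with ω hω
    refine propext ⟨fun h i _ v hv => ?_, fun h v hv => ?_⟩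
    · have hv' := h v hv.1
      by_cases hi : idx v = i
      · subst hi; exact hv'
      · have hvD : v ∈ D := by
          rw [← hCD _ _ hi]; exact ⟨hidx v (hBC hv.1), hv.2⟩
        rw [← hv', hω i v hvD]
        exact (hω (idx v) v hvD).symm
    · exact h (idx v) trivial v ⟨hv, hidx v (hBC hv)⟩
  -- As `B` contains `D`, only the term where `ξ` is the restriction of `η` survives.
  have hQ : ∀ B : Set V, B.Finite → D ⊆ B → B ⊆ ⋃ i, C i → ∀ η,
      Q (cyl B η) = δ (cyl D η) * ∏ i, (P i)[cyl (B ∩ C i) η | cyl D η] := by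
    intro B hB hDB hBC η
    have hη : cyl D (ext fun v => η v) = cyl D η := cyl_congr fun v hv => hext (fun v => η v) ⟨v, hv⟩
    rw [Measure.finsetSum_apply, Finset.sum_eq_single (fun v : D => η v)]
    · rw [Measure.smul_apply, Measure.map_apply hglue (measurableSet_cyl hB _), smul_eq_mul]
      by_cases h0 : δ (cyl D η) = 0
      · rw [hη, h0, zero_mul, zero_mul]
      · have h1 := hR (fun v => η v) (by rwa [hη]) B hB hBC η
        rw [hη] at h1
        rw [hη, h1]
    · intro ξ _ hne
      rw [Measure.smul_apply, Measure.map_apply hglue (measurableSet_cyl hB _), smul_eq_mul]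
      by_cases h0 : δ (cyl D (ext ξ)) = 0
      · rw [h0, zero_mul]
      · rw [hR _ h0 B hB hBC η, Finset.prod_eq_zero (Finset.mem_univ i₀), mul_zero]
        rw [cond_apply (measurableSet_cyl hDf _)]
        have : cyl D (ext ξ) ∩ cyl (B ∩ C i₀) η = ∅ := by
          rw [Set.eq_empty_iff_forall_notMem]
          rintro ζ ⟨h1, h2⟩
          refine hne (funext fun v => ?_)
          rw [← hext ξ v, ← h1 v v.2, h2 v ⟨hDB v.2, hD i₀ v.2⟩]
        rw [this, measure_empty, mul_zero]
    · intro h; exact absurd (Finset.mem_univ _) h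
  refine ⟨Q, fun k => agreeOn_of_cyl_eq (hC k) fun η => ?_, fun η => ?_⟩
  · rw [hQ (C k) (hC k) (hD k) (Set.subset_iUnion C k) η]
    by_cases h0 : δ (cyl D η) = 0
    · rw [h0, zero_mul]
      refine (le_antisymm ?_ bot_le).symm
      rw [bot_eq_zero, ← h0, ← hPc k η]
      exact measure_mono (cyl_anti (hD k) η)
    · rw [Finset.prod_eq_single k]
      · rw [Set.inter_self, cond_apply (measurableSet_cyl hDf _), hPc,
          Set.inter_eq_self_of_subset_right (cyl_anti (hD k) η), ← mul_assoc,
          ENNReal.mul_inv_cancel h0 (by rw [← hPc k]; exact measure_ne_top _ _), one_mul]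
      · intro i _ hik
        rw [hCD k i hik.symm]
        exact cond_apply_self (by rwa [hPc]) (measure_ne_top _ _)
      · intro h; exact absurd (Finset.mem_univ _) h
  · rw [hQ _ (Set.finite_iUnion hC) ((hD i₀).trans (Set.subset_iUnion C i₀)) subset_rfl η]
    simp_rw [Set.inter_eq_self_of_subset_right (Set.subset_iUnion C _)]

end Agreement

/-! ### The common intersection of the sub-balls -/

section Core

variable {V : Type*} {G : SimpleGraph V}

/-- The intersection of the balls of diameter `j` contained in `S`. -/
def core (G : SimpleGraph V) (j : ℕ) (S : Set V) : Set V := ⋂₀ subFull G j S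

theorem core_subset {j : ℕ} {S C : Set V} (hC : C ∈ subFull G j S) : core G j S ⊆ C :=
  Set.sInter_subset_of_mem hC

theorem two_le_numCopies {q : ℕ} (hq : 1 ≤ q) (j : ℕ) : 2 ≤ numCopies q j := by
  unfold numCopies; split_ifs <;> omega

theorem IsSunflower.exists_ne {q j : ℕ} {S D : Set V} (hq : 1 ≤ q) (h : IsSunflower G q j S D) :
    ∃ C ∈ subFull G j S, ∃ C' ∈ subFull G j S, C ≠ C' := by
  have h2 : 1 < (subFull G j S).ncard := by
    rw [h.ncard]; exact two_le_numCopies hq j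
  have := h.finite
  exact (Set.one_lt_ncard this).1 h2

theorem IsSunflower.eq_core {q j : ℕ} {S D : Set V} (hq : 1 ≤ q) (h : IsSunflower G q j S D) :
    D = core G j S := by
  obtain ⟨C, hC, C', hC', hne⟩ := h.exists_ne hq
  refine Set.Subset.antisymm (Set.subset_sInter h.subset) fun v hv => ?_
  rw [← h.pairwise hC hC' hne]
  exact ⟨hv C hC, hv C' hC'⟩

variable {q : ℕ} [G.LocallyFinite]

theorem IsFullSet.isSunflower (hG : G.IsTree) (hq : 1 ≤ q) (hreg : G.IsRegularOfDegree (q + 1))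
    {j : ℕ} {S : Set V} (hS : IsFullSet G (j + 1) S) : IsSunflower G q j S (core G j S) := by
  obtain ⟨x, y, h, rfl⟩ := hS
  have := isSunflower_coreSet hG hq hreg h
  rwa [this.eq_core hq] at this

theorem core_zero (hG : G.IsTree) (hq : 1 ≤ q) (hreg : G.IsRegularOfDegree (q + 1))
    {S : Set V} (hS : IsFullSet G 1 S) : core G 0 S = ∅ := by
  obtain ⟨x, y, h, rfl⟩ := hS
  rw [← (isSunflower_coreSet hG hq hreg h).eq_core hq, coreSet_zero]

theorem isFullSet_core (hG : G.IsTree) (hq : 1 ≤ q) (hreg : G.IsRegularOfDegree (q + 1))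
    {l : ℕ} {S : Set V} (hS : IsFullSet G (l + 2) S) : IsFullSet G l (core G (l + 1) S) := by
  obtain ⟨x, y, h, rfl⟩ := hS
  rw [← (isSunflower_coreSet hG hq hreg h).eq_core hq, coreSet_succ]
  exact ⟨x, y, IsCenter.add_two_iff.1 h, rfl⟩

/-- The induced map on petals is injective, and both balls have the same number of petals. -/
theorem IsometricOn.bijOn_subFull (hG : G.IsTree) (hq : 1 ≤ q)
    (hreg : G.IsRegularOfDegree (q + 1)) {j : ℕ} {S : Set V} (hS : IsFullSet G (j + 1) S)
    {f : V → V} (hf : IsometricOn G f S) :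
    Set.BijOn (f '' ·) (subFull G j S) (subFull G j (f '' S)) := by
  have hmaps : Set.MapsTo (f '' ·) (subFull G j S) (subFull G j (f '' S)) := fun C hC =>
    ⟨hC.1.image hG hreg (hf.mono hC.2), Set.image_mono hC.2⟩
  have hinj : Set.InjOn (f '' ·) (subFull G j S) := fun C hC C' hC' h =>
    ((hf.injOn hG.connected).image_eq_image_iff hC.2 hC'.2).1 h
  have hs := hS.isSunflower hG hq hreg
  have hs' := (hS.image hG hreg hf).isSunflower hG hq hreg
  refine ⟨hmaps, hinj, ?_⟩
  have : (f '' ·) '' subFull G j S = subFull G j (f '' S) :=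
    Set.eq_of_subset_of_ncard_le hmaps.image_subset
      (by rw [hinj.ncard_image, hs.ncard, hs'.ncard]) hs'.finite
  rw [Set.SurjOn, this]

theorem IsometricOn.image_core (hG : G.IsTree) (hq : 1 ≤ q)
    (hreg : G.IsRegularOfDegree (q + 1)) {j : ℕ} {S : Set V} (hS : IsFullSet G (j + 1) S)
    {f : V → V} (hf : IsometricOn G f S) : f '' core G j S = core G j (f '' S) := by
  have hs := hS.isSunflower hG hq hreg
  have hs' := (hS.image hG hreg hf).isSunflower hG hq hreg
  have hb := hf.bijOn_subFull hG hq hreg hS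
  obtain ⟨C, hC, C', hC', hne⟩ := hs.exists_ne hq
  rw [← hs.pairwise hC hC' hne, ← hs'.pairwise (hb.mapsTo hC) (hb.mapsTo hC')
    fun h => hne (hb.injOn hC hC' h)]
  exact (hf.injOn hG.connected).image_inter hC.2 hC'.2

end Core

/-! ### Invariant families of laws and their Markov extensions -/

section Families

variable {V : Type*} {Ω : Type*} {G : SimpleGraph V} [MeasurableSpace Ω]

/-- The Markov formula from the balls of diameter `j` in `S` to `S`. -/
def IsMarkov (G : SimpleGraph V) (j : ℕ) (S : Set V) (Q : Measure (V → Ω)) : Prop :=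
  ∀ η, Q (cyl S η) = Q (cyl (core G j S) η) *
    ∏ᶠ C ∈ subFull G j S, ((Q (cyl (core G j S) η))⁻¹ * Q (cyl C η))

/-- An isomorphism invariant family of laws on the balls of diameter `j`, consistent on the
intersections of the balls contained in a ball of diameter `j + 1`. -/
structure IsLevelFamily (G : SimpleGraph V) (j : ℕ) (P : Set V → Measure (V → Ω)) : Prop where
  prob : ∀ A, IsFullSet G j A → IsProbabilityMeasure (P A)
  equivariant : ∀ A, IsFullSet G j A → ∀ f, IsometricOn G f A →
    AgreeOn A (P A) ((P (f '' A)).map (· ∘ f))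
  consistent : ∀ S, IsFullSet G (j + 1) S → ∀ C ∈ subFull G j S, ∀ C' ∈ subFull G j S,
    AgreeOn (core G j S) (P C) (P C')

/-- The laws `P'` on the balls of diameter `j + 1` extend the laws `P` on those of diameter `j`
by the Markov formula. -/
structure IsMarkovExtension (G : SimpleGraph V) (j : ℕ) (P P' : Set V → Measure (V → Ω)) :
    Prop where
  agree : ∀ S, IsFullSet G (j + 1) S → ∀ C ∈ subFull G j S, AgreeOn C (P' S) (P C)
  markov : ∀ S, IsFullSet G (j + 1) S → IsMarkov G j S (P' S)

/-- Local invariance of the marginal of a measure on `T`, in terms of isometric maps into `T`. -/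
def IsIsometryInvariant (G : SimpleGraph V) (T : Set V) (M : Measure (V → Ω)) : Prop :=
  ∀ A : Set V, A.Nonempty → GeodConvex G A → ∀ f g : V → V, IsometricOn G f A →
    IsometricOn G g A → Set.MapsTo f A T → Set.MapsTo g A T →
      AgreeOn A (M.map (· ∘ f)) (M.map (· ∘ g))

variable {q : ℕ} [G.LocallyFinite]

/-- The law on a ball `A` is `M` transported along a chosen isometry of `A` onto `T`. Isometry
invariance makes the choice immaterial, and applied to the core it also gives consistency. -/
theorem exists_isLevelFamily (hG : G.IsTree) (hq : 1 ≤ q) (hreg : G.IsRegularOfDegree (q + 1))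
    {k : ℕ} {T : Set V} (hT : IsFullSet G k T) (M : Measure (V → Ω)) [IsProbabilityMeasure M]
    (hM : IsIsometryInvariant G T M) :
    ∃ P : Set V → Measure (V → Ω), IsLevelFamily G k P ∧ AgreeOn T (P T) M := by
  have hex : ∀ A, ∃ f : V → V, IsFullSet G k A → IsometricOn G f A ∧ f '' A = T := by
    intro A
    by_cases hA : IsFullSet G k A
    · obtain ⟨f, hf⟩ := hA.exists_isometricOn hG hreg hT
      exact ⟨f, fun _ => hf⟩
    · exact ⟨id, fun h => absurd h hA⟩
  choose F hF using hex
  have hmaps : ∀ {A}, IsFullSet G k A → Set.MapsTo (F A) A T := fun {A} hA =>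
    Set.mapsTo_iff_image_subset.2 (hF A hA).2.subset
  have hprob : ∀ A, IsProbabilityMeasure (M.map (· ∘ F A)) := fun A =>
    Measure.isProbabilityMeasure_map (measurable_comp_right _).aemeasurable
  refine ⟨fun A => M.map (· ∘ F A), ⟨fun A _ => hprob A, ?_, ?_⟩, ?_⟩
  · intro A hA f hf
    have hA' := hA.image hG hreg hf
    rw [Measure.map_map (measurable_comp_right _) (measurable_comp_right _)]
    exact hM A hA.nonempty (hA.geodConvex hG) (F A) (F (f '' A) ∘ f) (hF A hA).1
      (hf.comp (hF _ hA').1 (Set.mapsTo_image f A)) (hmaps hA)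
      ((hmaps hA').comp (Set.mapsTo_image f A))
  · intro S hS C hC C' hC'
    cases k with
    | zero => rw [core_zero hG hq hreg hS]; exact agreeOn_empty _ _
    | succ l =>
      have hcore := isFullSet_core hG hq hreg hS
      have h1 := core_subset hC
      have h2 := core_subset hC'
      exact hM _ hcore.nonempty (hcore.geodConvex hG) _ _ ((hF C hC.1).1.mono h1)
        ((hF C' hC'.1).1.mono h2) ((hmaps hC.1).mono_left h1) ((hmaps hC'.1).mono_left h2)
  · have := hM T hT.nonempty (hT.geodConvex hG) (F T) id (hF T hT).1 (isometricOn_id T) (hmaps hT)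
      (Set.mapsTo_id T)
    simpa [Function.comp_def] using this

variable [Finite Ω] [DiscreteMeasurableSpace Ω]

theorem IsMarkov.congr (hG : G.IsTree) (hq : 1 ≤ q) (hreg : G.IsRegularOfDegree (q + 1)) {j : ℕ}
    {S : Set V} (hS : IsFullSet G (j + 1) S) {Q Q' : Measure (V → Ω)} (h : AgreeOn S Q Q')
    (hQ : IsMarkov G j S Q) : IsMarkov G j S Q' := by
  intro η
  have hs := hS.isSunflower hG hq hreg
  obtain ⟨C₀, hC₀, -⟩ := hs.exists_ne hq
  have hfin := hS.finite hG.connected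
  have key : ∀ B ⊆ S, Q' (cyl B η) = Q (cyl B η) := fun B hB =>
    ((h.mono hB).cyl_eq (hfin.subset hB) η).symm
  rw [key S subset_rfl, key _ ((core_subset hC₀).trans hC₀.2), hQ η]
  congr 1
  exact finprod_mem_congr rfl fun C hC => by rw [key C hC.2]

theorem exists_law_of_consistent [Nonempty Ω] (hG : G.IsTree) (hq : 1 ≤ q)
    (hreg : G.IsRegularOfDegree (q + 1)) {j : ℕ} {P : Set V → Measure (V → Ω)}
    (hP : IsLevelFamily G j P) {S : Set V} (hS : IsFullSet G (j + 1) S) :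
    ∃ Q : Measure (V → Ω), (∀ C ∈ subFull G j S, AgreeOn C Q (P C)) ∧ IsMarkov G j S Q := by
  have hs := hS.isSunflower hG hq hreg
  obtain ⟨C₀, hC₀, -⟩ := hs.exists_ne hq
  have := hs.finite.fintype
  have : Nonempty (subFull G j S) := ⟨⟨C₀, hC₀⟩⟩
  have : ∀ C : subFull G j S, IsProbabilityMeasure (P C) := fun C => hP.prob C C.2.1
  have hfin : ∀ C ∈ subFull G j S, C.Finite := fun C hC => hC.1.finite hG.connected
  have hDfin := (hfin C₀ hC₀).subset (core_subset hC₀)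
  obtain ⟨Q, hQ, hQm⟩ := exists_amalgamation (C := fun C : subFull G j S => (C : Set V))
    (D := core G j S) (fun C => hfin C C.2) (fun C => core_subset C.2)
    (fun C C' h => hs.pairwise C.2 C'.2 fun h' => h (Subtype.ext h')) (fun C => P C) (P C₀)
    (fun C => hP.consistent S hS C C.2 C₀ hC₀)
  have hU : ⋃ C : subFull G j S, (C : Set V) = S := by
    ext v
    rw [Set.mem_iUnion]
    constructor
    · rintro ⟨C, hv⟩; exact C.2.2 hv
    · intro hv
      obtain ⟨C, hC, hvC⟩ := hs.cover v hv
      exact ⟨⟨C, hC⟩, hvC⟩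
  refine ⟨Q, fun C hC => hQ ⟨C, hC⟩, fun η => ?_⟩
  have hD : ∀ C ∈ subFull G j S, P C (cyl (core G j S) η) = Q (cyl (core G j S) η) := fun C hC =>
    (((hQ ⟨C, hC⟩).mono (core_subset hC)).cyl_eq hDfin η).symm
  rw [hU] at hQm
  rw [hQm η, hD C₀ hC₀, ← finprod_set_coe_eq_finprod_mem, finprod_eq_prod_of_fintype]
  congr 1
  refine Finset.prod_congr rfl fun C _ => ?_
  rw [cond_apply (measurableSet_cyl hDfin η), hD C C.2,
    Set.inter_eq_self_of_subset_right (cyl_anti (core_subset C.2) η),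
    (hQ C).cyl_eq (hfin C C.2)]

/-- The induction step: the Markov formula determines the law on `S` from the petals, so invariance
and consistency are inherited. -/
theorem exists_isMarkovExtension [Nonempty Ω] (hG : G.IsTree) (hq : 1 ≤ q)
    (hreg : G.IsRegularOfDegree (q + 1)) {j : ℕ} {P : Set V → Measure (V → Ω)}
    (hP : IsLevelFamily G j P) :
    ∃ P', IsLevelFamily G (j + 1) P' ∧ IsMarkovExtension G j P P' := by
  have hex : ∀ S, ∃ Q : Measure (V → Ω), IsFullSet G (j + 1) S →
      (∀ C ∈ subFull G j S, AgreeOn C Q (P C)) ∧ IsMarkov G j S Q := by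
    intro S
    by_cases hS : IsFullSet G (j + 1) S
    · obtain ⟨Q, hQ⟩ := exists_law_of_consistent hG hq hreg hP hS
      exact ⟨Q, fun _ => hQ⟩
    · exact ⟨0, fun h => absurd h hS⟩
  choose P' hP' using hex
  have hsun : ∀ {S}, IsFullSet G (j + 1) S → IsSunflower G q j S (core G j S) := fun hS =>
    hS.isSunflower hG hq hreg
  refine ⟨P', ⟨?_, ?_, ?_⟩, ⟨fun S hS => (hP' S hS).1, fun S hS => (hP' S hS).2⟩⟩
  · intro S hS
    obtain ⟨C, hC, -⟩ := (hsun hS).exists_ne hq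
    have := hP.prob C hC.1
    exact ((hP' S hS).1 C hC).isProbabilityMeasure
  · intro S hS f hf
    have hS' := hS.image hG hreg hf
    have hSf := hS.finite hG.connected
    have hcore := hf.image_core hG hq hreg hS
    obtain ⟨C₀, hC₀, -⟩ := (hsun hS).exists_ne hq
    refine agreeOn_of_cyl_eq hSf fun ζ => ?_
    obtain ⟨η, hη⟩ := exists_comp_eqOn (hf.injOn hG.connected) ζ
    -- Each factor of the product for `S` equals the corresponding factor for `f '' S`, by
    -- equivariance of the old law on a petal.
    have key : ∀ B, ∀ C ∈ subFull G j S, B ⊆ C →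
        P' S (cyl B (η ∘ f)) = P' (f '' S) (cyl (f '' B) η) := by
      intro B C hC hB
      have hBf : B.Finite := hSf.subset (hB.trans hC.2)
      have hfC : f '' C ∈ subFull G j (f '' S) := (hf.bijOn_subFull hG hq hreg hS).mapsTo hC
      rw [(((hP' S hS).1 C hC).mono hB).cyl_eq hBf,
        ((hP.equivariant C hC.1 f (hf.mono hC.2)).mono hB).cyl_eq hBf, map_comp_cyl hBf,
        ((((hP' _ hS').1 _ hfC).mono (Set.image_mono hB)).cyl_eq (hBf.image f))]
    rw [cyl_congr hη, map_comp_cyl hSf, (hP' S hS).2, (hP' _ hS').2, ← hcore,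
      key _ C₀ hC₀ (core_subset hC₀)]
    congr 1
    exact finprod_mem_eq_of_bijOn _ (hf.bijOn_subFull hG hq hreg hS) fun C hC => by
      rw [key C C hC subset_rfl]
  · intro S hS C hC C' hC'
    have hcore := isFullSet_core hG hq hreg hS
    exact ((hP' C hC.1).1 _ ⟨hcore, core_subset hC⟩).trans
      ((hP' C' hC'.1).1 _ ⟨hcore, core_subset hC'⟩).symm

theorem exists_isMarkovExtension_seq [Nonempty Ω] (hG : G.IsTree) (hq : 1 ≤ q)
    (hreg : G.IsRegularOfDegree (q + 1)) {k : ℕ} {P₀ : Set V → Measure (V → Ω)}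
    (hP₀ : IsLevelFamily G k P₀) :
    ∃ P : ℕ → Set V → Measure (V → Ω), P 0 = P₀ ∧ (∀ n, IsLevelFamily G (k + n) (P n)) ∧
      ∀ n, IsMarkovExtension G (k + n) (P n) (P (n + 1)) := by
  choose next hnext using fun (n : ℕ) (P : {P : Set V → Measure (V → Ω) //
    IsLevelFamily G (k + n) P}) => exists_isMarkovExtension hG hq hreg P.2
  let seq : (n : ℕ) → {P : Set V → Measure (V → Ω) // IsLevelFamily G (k + n) P} := fun n =>
    Nat.rec ⟨P₀, hP₀⟩ (fun n P => ⟨next n P, (hnext n P).1⟩) n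
  exact ⟨fun n => (seq n).1, rfl, fun n => (seq n).2, fun n => (hnext n (seq n)).2⟩

end Families

/-! ### The limit measure on the whole tree -/

section Limit

variable {V : Type*} {Ω : Type*} {G : SimpleGraph V}

theorem countable_of_locallyFinite (hG : G.Connected) [G.LocallyFinite] : Countable V := by
  obtain ⟨x⟩ := hG.nonempty
  have h : (⋃ n, {v | G.dist x v ≤ n}) = Set.univ :=
    Set.eq_univ_of_forall fun v => Set.mem_iUnion.2 ⟨G.dist x v, le_refl (G.dist x v)⟩
  rw [← Set.countable_univ_iff, ← h]
  exact Set.countable_iUnion fun n => (finite_dist_le hG x n).countable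

variable [MeasurableSpace Ω]

/-- The probability measures on the compact configuration space form a compact space, so an
ultrafilter limit exists. Cylinders over finite sets are clopen, hence their masses converge and
eventually constant ones are kept. -/
theorem exists_limit_measure [Finite Ω] [DiscreteMeasurableSpace Ω] [Countable V] [Nonempty Ω]
    (Q : ℕ → Measure (V → Ω))
    [hQ : ∀ n, IsProbabilityMeasure (Q n)] :
    ∃ μ : Measure (V → Ω), IsProbabilityMeasure μ ∧ ∀ (A : Set V) (R : Measure (V → Ω)),
      A.Finite → (∀ᶠ n in Filter.atTop, AgreeOn A (Q n) R) → AgreeOn A μ R := by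
  let _ : TopologicalSpace Ω := ⊥
  have : DiscreteTopology Ω := ⟨rfl⟩
  have : BorelSpace Ω := inferInstance
  let u : ℕ → ProbabilityMeasure (V → Ω) := fun n => ⟨Q n, hQ n⟩
  let U : Ultrafilter ℕ := Filter.hyperfilter ℕ
  obtain ⟨μ, -, hμ⟩ := isCompact_univ.ultrafilter_le_nhds (U.map u) (by simp)
  refine ⟨μ, inferInstance, fun A R hA hR => agreeOn_of_cyl_eq hA fun η => ?_⟩
  have hclopen : IsClopen (cyl A η) := by
    have : cyl A η = ⋂ v ∈ A, (fun ξ : V → Ω => ξ v) ⁻¹' {η v} := by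
      ext; simp [cyl]
    rw [this]
    exact hA.isClopen_biInter fun v _ =>
      (isClopen_discrete {η v}).preimage (continuous_apply v)
  have hlim : Filter.Tendsto u U (nhds μ) := hμ
  have h1 := ProbabilityMeasure.tendsto_measure_of_null_frontier_of_tendsto' hlim
    (E := cyl A η) (by rw [hclopen.frontier_eq]; simp)
  have hU : (U : Filter ℕ) ≤ Filter.atTop := by
    rw [← Nat.cofinite_eq_atTop]; exact Filter.hyperfilter_le_cofinite
  have h2 : (fun n => (u n : Measure (V → Ω)) (cyl A η)) =ᶠ[(U : Filter ℕ)]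
      fun _ => R (cyl A η) := by
    filter_upwards [hU hR] with n hn
    exact hn.cyl_eq hA η
  exact tendsto_nhds_unique (h1.congr' h2) tendsto_const_nhds

theorem eq_of_agreeOn_finite {μ ν : Measure (V → Ω)} [IsProbabilityMeasure μ]
    [IsProbabilityMeasure ν] (h : ∀ A : Set V, A.Finite → AgreeOn A μ ν) : μ = ν := by
  have : ∀ I : Finset V, IsFiniteMeasure (ν.map (I.restrict : (V → Ω) → _)) := fun I =>
    Measure.isFiniteMeasure_map _ _
  refine IsProjectiveLimit.unique (P := fun I : Finset V => ν.map (I.restrict : (V → Ω) → _))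
    (fun I => ?_) fun I => rfl
  exact h I I.finite_toSet

/-- An increasing sequence of balls exhausting the tree. -/
def exhaust (G : SimpleGraph V) (x y : V) (j : ℕ) : Set V :=
  fullSet G j x (if Even j then x else y)

theorem isCenter_exhaust {x y : V} (h : G.Adj x y) (j : ℕ) :
    IsCenter G j x (if Even j then x else y) := by
  by_cases hj : Even j
  · rw [if_pos hj]; exact Or.inl ⟨hj, rfl⟩
  · rw [if_neg hj]; exact Or.inr ⟨Nat.not_even_iff_odd.1 hj, h⟩

theorem isFullSet_exhaust {x y : V} (h : G.Adj x y) (j : ℕ) : IsFullSet G j (exhaust G x y j) :=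
  ⟨_, _, isCenter_exhaust h j, rfl⟩

theorem exhaust_subset_succ (hG : G.IsTree) {x y : V} (h : G.Adj x y) (j : ℕ) :
    exhaust G x y j ⊆ exhaust G x y (j + 1) := by
  intro v hv
  have t := hG.dist_eq_dist_add_one_of_adj v h
  simp only [G.dist_comm (u := v)] at t
  unfold exhaust at *
  rw [mem_fullSet] at *
  by_cases hj : Even j
  · rw [if_pos hj] at hv
    rw [if_neg (by simpa [parity_simps] using hj)]
    omega
  · rw [if_neg hj] at hv
    rw [if_pos (by simpa [parity_simps] using hj)]
    rw [Nat.not_even_iff_odd] at hj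
    obtain ⟨m, rfl⟩ := hj
    omega

theorem exists_subset_exhaust (hG : G.IsTree) {x y : V} (h : G.Adj x y) {A : Set V}
    (hA : A.Finite) (k : ℕ) : ∃ n, A ⊆ exhaust G x y (k + n) := by
  obtain ⟨N, hN⟩ := (hA.image (G.dist x)).bddAbove
  -- The distances to the two points of the centre are at most `N` and `N + 1`.
  refine ⟨2 * N + 1, fun v hv => ?_⟩
  have h1 : G.dist x v ≤ N := hN (Set.mem_image_of_mem _ hv)
  have h2 : G.dist x (if Even (k + (2 * N + 1)) then x else y) ≤ 1 := by
    split_ifs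
    · simp
    · rw [SimpleGraph.dist_eq_one_iff_adj.2 h]
  have h3 := hG.connected.dist_triangle (u := if Even (k + (2 * N + 1)) then x else y) (v := x)
    (w := v)
  rw [G.dist_comm (v := x)] at h3
  unfold exhaust
  rw [mem_fullSet]
  omega

variable {k : ℕ} {P : ℕ → Set V → Measure (V → Ω)}

theorem agreeOn_exhaust (hG : G.IsTree)
    (hext : ∀ n, IsMarkovExtension G (k + n) (P n) (P (n + 1))) {x y : V} (h : G.Adj x y) {m n : ℕ}
    (hmn : m ≤ n) : AgreeOn (exhaust G x y (k + m)) (P n (exhaust G x y (k + n)))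
      (P m (exhaust G x y (k + m))) := by
  induction n, hmn using Nat.le_induction with
  | base => rfl
  | succ n hmn ih =>
    refine AgreeOn.trans ?_ ih
    refine ((hext n).agree _ (isFullSet_exhaust h _) _
      ⟨isFullSet_exhaust h (k + n), exhaust_subset_succ hG h _⟩).mono ?_
    exact monotone_nat_of_le_succ (exhaust_subset_succ hG h) (by omega)

variable {q : ℕ} [G.LocallyFinite]

/-- The ball is enlarged by one in diameter while its centre moves towards `x`: from a vertex to the
edge leading to `x`, from an edge to its end nearer to `x`. The sum of the distances from `x` to the
centre drops each time until the centre is `x`. -/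
theorem exists_agreeOn_exhaust (hG : G.IsTree) (hq : 1 ≤ q) (hreg : G.IsRegularOfDegree (q + 1))
    (hext : ∀ n, IsMarkovExtension G (k + n) (P n) (P (n + 1))) {x y : V} (h : G.Adj x y) {m : ℕ}
    {A : Set V} (hA : IsFullSet G (k + m) A) :
    ∃ n, A ⊆ exhaust G x y (k + n) ∧ AgreeOn A (P n (exhaust G x y (k + n))) (P m A) := by
  obtain ⟨a, b, hab, rfl⟩ := hA
  induction hd : G.dist x a + G.dist x b using Nat.strong_induction_on generalizing a b m with
  | _ d ih =>
  have step : ∀ a' b', IsCenter G (k + (m + 1)) a' b' →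
      fullSet G (k + m) a b ⊆ fullSet G (k + (m + 1)) a' b' → G.dist x a' + G.dist x b' < d →
      ∃ n, fullSet G (k + m) a b ⊆ exhaust G x y (k + n) ∧
        AgreeOn (fullSet G (k + m) a b) (P n (exhaust G x y (k + n)))
          (P m (fullSet G (k + m) a b)) := by
    intro a' b' hc hsub hlt
    obtain ⟨n, h1, h2⟩ := ih _ hlt a' b' hc rfl
    exact ⟨n, hsub.trans h1, (h2.mono hsub).trans
      ((hext m).agree _ ⟨a', b', hc, rfl⟩ _ ⟨⟨a, b, hab, rfl⟩, hsub⟩)⟩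
  rcases hab with ⟨he, rfl⟩ | ⟨ho, hadj⟩
  · by_cases hax : a = x
    · subst hax
      have : exhaust G a y (k + m) = fullSet G (k + m) a a := by rw [exhaust, if_pos he]
      exact ⟨m, this.symm.subset, by rw [this]; rfl⟩
    · obtain ⟨w, haw, hw⟩ := exists_adj_dist_eq hG.connected hax
      have hc : IsCenter G (k + (m + 1)) a w := Or.inr ⟨he.add_one, haw⟩
      have hmem : fullSet G (k + m) a a ∈ subFull G (k + m) (fullSet G (k + m + 1) a w) := by
        rw [subFull_edge hG hq hreg he haw]; exact Or.inl rfl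
      exact step a w hc hmem.2 (by omega)
  · have key : ∀ {c e : V}, G.Adj c e → fullSet G (k + m) a b = fullSet G (k + m) c e →
        fullSet G (k + m) a b ⊆ fullSet G (k + m + 1) c c := by
      intro c e hce heq
      have : fullSet G (k + m) c e ∈ subFull G (k + m) (fullSet G (k + m + 1) c c) := by
        rw [subFull_vertex hG hq hreg ho c]; exact ⟨e, hce, rfl⟩
      rw [heq]
      exact this.2
    rcases hG.dist_eq_dist_add_one_of_adj x hadj with h1 | h1
    · exact step b b (Or.inl ⟨ho.add_one, rfl⟩) (key hadj.symm (fullSet_comm _ _ _)) (by omega)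
    · exact step a a (Or.inl ⟨ho.add_one, rfl⟩) (key hadj rfl) (by omega)

/-- A sequence of Markov extensions has a limit measure on the configurations of the lattice. -/
theorem exists_measure_agreeOn [Finite Ω] [DiscreteMeasurableSpace Ω] [Nonempty Ω]
    (hG : G.IsTree) (hq : 1 ≤ q)
    (hreg : G.IsRegularOfDegree (q + 1)) (hP : ∀ n, IsLevelFamily G (k + n) (P n))
    (hext : ∀ n, IsMarkovExtension G (k + n) (P n) (P (n + 1))) :
    ∃ μ : Measure (V → Ω), IsProbabilityMeasure μ ∧
      ∀ m A, IsFullSet G (k + m) A → AgreeOn A μ (P m A) := by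
  have := countable_of_locallyFinite hG.connected
  obtain ⟨x⟩ := hG.connected.nonempty
  obtain ⟨y, hxy⟩ := exists_adj_of_regular hq hreg x
  have hprob : ∀ n, IsProbabilityMeasure (P n (exhaust G x y (k + n))) := fun n =>
    (hP n).prob _ (isFullSet_exhaust hxy _)
  obtain ⟨μ, hμ, hlim⟩ := exists_limit_measure fun n => P n (exhaust G x y (k + n))
  refine ⟨μ, hμ, fun m A hA => hlim A _ (hA.finite hG.connected) ?_⟩
  obtain ⟨n, hn, hag⟩ := exists_agreeOn_exhaust hG hq hreg hext hxy hA
  filter_upwards [Filter.eventually_ge_atTop n] with n' hn'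
  exact ((agreeOn_exhaust hG hext hxy hn').mono hn).trans hag

theorem agreeOn_map_comp (hG : G.IsTree) (hreg : G.IsRegularOfDegree (q + 1))
    (hP : ∀ n, IsLevelFamily G (k + n) (P n)) {μ : Measure (V → Ω)}
    (hμ : ∀ m A, IsFullSet G (k + m) A → AgreeOn A μ (P m A)) {m : ℕ} {A : Set V}
    (hA : IsFullSet G (k + m) A) {f : V → V} (hf : IsometricOn G f A) :
    AgreeOn A (μ.map (· ∘ f)) μ :=
  ((hμ m _ (hA.image hG hreg hf)).map_comp (Set.mapsTo_image _ _)).trans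
    (((hP m).equivariant _ hA f hf).symm.trans (hμ m _ hA).symm)

theorem map_comp_eq_of_agreeOn (hG : G.IsTree) (hq : 1 ≤ q)
    (hreg : G.IsRegularOfDegree (q + 1)) (hP : ∀ n, IsLevelFamily G (k + n) (P n))
    {μ : Measure (V → Ω)} [IsProbabilityMeasure μ]
    (hμ : ∀ m A, IsFullSet G (k + m) A → AgreeOn A μ (P m A)) (φ : G ≃g G) :
    μ.map (fun η x => η (φ x)) = μ := by
  obtain ⟨x⟩ := hG.connected.nonempty
  obtain ⟨y, hxy⟩ := exists_adj_of_regular hq hreg x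
  have hprob : IsProbabilityMeasure (μ.map (· ∘ φ)) :=
    Measure.isProbabilityMeasure_map (measurable_comp_right _).aemeasurable
  refine eq_of_agreeOn_finite (μ := μ.map (· ∘ φ)) fun A hA => ?_
  obtain ⟨n, hn⟩ := exists_subset_exhaust hG hxy hA k
  have hfull := isFullSet_exhaust hxy (k + n)
  have hiso : IsometricOn G φ (exhaust G x y (k + n)) := fun u _ v _ =>
    dist_iso_eq hG.connected.preconnected φ u v
  refine AgreeOn.mono ?_ hn
  exact agreeOn_map_comp hG hreg hP hμ hfull hiso

end Limit

/-! ### Transfer to subgraphs and the symmetrized formula -/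

section Subgraphs

variable {V : Type*} {Ω : Type*} {G : SimpleGraph V}

theorem indSub_empty : indSub G ∅ = ⊥ :=
  eq_bot_iff.2 ⟨subset_rfl, fun _ _ h => (h.1 : _ ∈ (∅ : Set V)).elim⟩

theorem iInf_indSub {ι : Sort*} (C : ι → Set V) : ⨅ i, indSub G (C i) = indSub G (⋂ i, C i) := by
  refine le_antisymm (le_indSub ?_) (le_iInf fun i => indSub_mono_iff.2 (Set.iInter_subset C i))
  rw [SimpleGraph.Subgraph.verts_iInf]
  exact subset_rfl

/-- Extension of a configuration on a subgraph to the whole graph by a default value. -/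
noncomputable def extendConfig [Nonempty Ω] (H : G.Subgraph) (ξ : Config Ω H) : V → Ω := by
  classical exact fun v => if hv : v ∈ H.verts then ξ ⟨v, hv⟩ else Classical.arbitrary Ω

theorem extendConfig_apply [Nonempty Ω] (H : G.Subgraph) (ξ : Config Ω H) {v : V}
    (hv : v ∈ H.verts) : extendConfig H ξ v = ξ ⟨v, hv⟩ := dif_pos hv

variable [MeasurableSpace Ω]

theorem measurable_restr (H : G.Subgraph) : Measurable (restr H : (V → Ω) → Config Ω H) :=
  measurable_restrictTo H.verts

theorem measurable_restrSub {K H : G.Subgraph} (h : K ≤ H) :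
    Measurable (restrSub h : Config Ω H → Config Ω K) :=
  measurable_pi_lambda _ fun _ => measurable_pi_apply _

theorem marginal_eq_of_agreeOn {A : Set V} {P Q : Measure (V → Ω)} (h : AgreeOn A P Q) :
    marginal P (indSub G A) = marginal Q (indSub G A) := h

theorem measurable_extendConfig [Nonempty Ω] (H : G.Subgraph) :
    Measurable (extendConfig H : Config Ω H → V → Ω) := by
  refine measurable_pi_lambda _ fun v => ?_
  by_cases hv : v ∈ H.verts
  · simp only [extendConfig_apply H _ hv]
    exact measurable_pi_apply _
  · simp only [extendConfig, dif_neg hv]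
    exact measurable_const

theorem marginal_map_extendConfig [Nonempty Ω] (H : G.Subgraph) (ν : Measure (Config Ω H)) :
    marginal (ν.map (extendConfig H)) H = ν := by
  rw [marginal, Measure.map_map (measurable_restr H) (measurable_extendConfig H)]
  have : restr H ∘ extendConfig H = (id : Config Ω H → Config Ω H) := by
    funext ξ x
    exact extendConfig_apply H ξ x.2
  rw [this, Measure.map_id]

/-- Locally invariant measures are invariant under isometric maps into the subgraph. -/
theorem LocallyInvariant.isIsometryInvariant [Nonempty Ω] (hG : G.IsTree) {T : Set V}
    {ν : Measure (Config Ω (indSub G T))} (hν : LocallyInvariant (indSub G T) ν) :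
    IsIsometryInvariant G T (ν.map (extendConfig (indSub G T))) := by
  intro A hne hA f g hf hg hfT hgT
  have hconn : (indSub G A).coe.Connected := by
    have : Nonempty (indSub G A).verts := hne.to_subtype
    exact ⟨hA.preconnected hG.connected⟩
  let φf := hf.iso hG.connected rfl
  let φg := hg.iso hG.connected rfl
  have h1 : indSub G (f '' A) ≤ indSub G T := indSub_mono_iff.2 hfT.image_subset
  have h2 : indSub G (g '' A) ≤ indSub G T := indSub_mono_iff.2 hgT.image_subset
  -- Local invariance is applied to the isomorphism from `f '' A` through `A` to `g '' A`, then
  -- pulled back along `φf`.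
  have key := hν _ _ h1 h2 ⟨φf.connected_iff.1 hconn⟩ ⟨φg.connected_iff.1 hconn⟩
    (φf.symm.trans φg)
  have hm : Measurable fun (ξ : Config Ω (indSub G (f '' A))) (a : A) => ξ (φf a) :=
    measurable_pi_lambda _ fun _ => measurable_pi_apply _
  have hm' : Measurable fun (ξ : Config Ω (indSub G (g '' A)))
      (x : (indSub G (f '' A)).verts) => ξ ((φf.symm.trans φg) x) :=
    measurable_pi_lambda _ fun _ => measurable_pi_apply _
  have e := congrArg (Measure.map fun (ξ : Config Ω (indSub G (f '' A))) (a : A) => ξ (φf a)) key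
  rw [copy, marginalSub, marginalSub, Measure.map_map hm' (measurable_restrSub h2),
    Measure.map_map hm (hm'.comp (measurable_restrSub h2)),
    Measure.map_map hm (measurable_restrSub h1)] at e
  have hx := measurable_extendConfig (Ω := Ω) (indSub G T)
  rw [AgreeOn, Measure.map_map (measurable_comp_right f) hx,
    Measure.map_map (measurable_comp_right g) hx,
    Measure.map_map (measurable_restrictTo A) ((measurable_comp_right f).comp hx),
    Measure.map_map (measurable_restrictTo A) ((measurable_comp_right g).comp hx)]
  have e1 : (restrictTo A ∘ (fun η : V → Ω => η ∘ f) ∘ extendConfig (indSub G T)) =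
      (fun (ξ : Config Ω (indSub G (f '' A))) (a : A) => ξ (φf a)) ∘ restrSub h1 := by
    funext ξ a
    exact extendConfig_apply _ ξ (hfT a.2)
  have e2 : (restrictTo A ∘ (fun η : V → Ω => η ∘ g) ∘ extendConfig (indSub G T)) =
      (fun (ξ : Config Ω (indSub G (f '' A))) (a : A) => ξ (φf a)) ∘
        (fun (ξ : Config Ω (indSub G (g '' A))) (x : (indSub G (f '' A)).verts) =>
          ξ ((φf.symm.trans φg) x)) ∘ restrSub h2 := by
    funext ξ a
    have : (φf.symm.trans φg) (φf a) = φg a := congrArg φg (φf.symm_apply_apply a)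
    simp only [Function.comp_apply, this]
    exact extendConfig_apply _ ξ (hgT a.2)
  rw [e1, e2, e]

theorem copy_marginal_eq_map (μ : Measure (V → Ω)) {A B : Set V}
    (φ : (indSub G A).coe ≃g (indSub G B).coe) {f : V → V}
    (hf : ∀ u : (indSub G A).verts, (φ u : V) = f u) :
    copy φ (marginal μ (indSub G B)) = marginal (μ.map (· ∘ f)) (indSub G A) := by
  have hm : Measurable fun (ξ : Config Ω (indSub G B)) (x : (indSub G A).verts) => ξ (φ x) :=
    measurable_pi_lambda _ fun _ => measurable_pi_apply _
  rw [copy, marginal, marginal, Measure.map_map hm (measurable_restr _),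
    Measure.map_map (measurable_restr _) (measurable_comp_right f)]
  congr 1
  funext η x
  exact congrArg η (hf x)

/-- Null cores cause no discrepancy: the extended inverse of 0 is `⊤`, which `toReal` sends to the
real value `0⁻¹ = 0`. -/
theorem IsMarkov.real_eq {j r : ℕ} {S : Set V} {μ : Measure (V → Ω)} (h : IsMarkov G j S μ)
    (e : Fin r ≃ subFull G j S) (η : V → Ω) :
    μ.real (cyl S η) = μ.real (cyl (core G j S) η) *
      ∏ i, ((μ.real (cyl (core G j S) η))⁻¹ * μ.real (cyl (e i) η)) := by
  have := Fintype.ofEquiv _ e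
  rw [Measure.real, h η, ← finprod_set_coe_eq_finprod_mem, finprod_eq_prod_of_fintype,
    ← e.prod_comp, ENNReal.toReal_mul, ENNReal.toReal_prod]
  simp only [ENNReal.toReal_mul, ENNReal.toReal_inv]
  rfl

variable [Finite Ω] [DiscreteMeasurableSpace Ω]

theorem marginal_real_singleton (μ : Measure (V → Ω)) {H : G.Subgraph} (hH : H.verts.Finite)
    (η : V → Ω) : (marginal μ H).real {restr H η} = μ.real (cyl H.verts η) := by
  have := hH.to_subtype
  rw [marginal, map_measureReal_apply (measurable_restr H) (measurableSet_singleton _)]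
  congr 1
  exact restrictTo_preimage_singleton H.verts η

theorem cond_marginal_real (μ : Measure (V → Ω)) {C : G.Subgraph} (hC : C.verts.Finite)
    {D : Set V} (hD : D ⊆ C.verts) (η : V → Ω) :
    (ProbabilityTheory.cond (marginal μ C) {ξ | ∀ x : C.verts, (x : V) ∈ D → ξ x = η x}).real
      {ξ | ∀ x : C.verts, (x : V) ∉ D → ξ x = η x} =
      (μ.real (cyl D η))⁻¹ * μ.real (cyl C.verts η) := by
  have := hC.to_subtype
  have hm : ∀ s : Set (Config Ω C), MeasurableSet s := fun s => s.toFinite.measurableSet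
  have e1 : restr C ⁻¹' {ξ | ∀ x : C.verts, (x : V) ∈ D → ξ x = η x} = cyl D η := by
    ext ξ
    exact ⟨fun h v hv => h ⟨v, hD hv⟩ hv, fun h x hx => h x hx⟩
  have e2 : restr C ⁻¹' ({ξ | ∀ x : C.verts, (x : V) ∈ D → ξ x = η x} ∩
      {ξ | ∀ x : C.verts, (x : V) ∉ D → ξ x = η x}) = cyl C.verts η := by
    ext ξ
    refine ⟨fun h v hv => ?_, fun h => ⟨fun x _ => h x x.2, fun x _ => h x x.2⟩⟩
    by_cases hvD : v ∈ D
    · exact h.1 ⟨v, hv⟩ hvD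
    · exact h.2 ⟨v, hv⟩ hvD
  rw [Measure.real, cond_apply (hm _), ENNReal.toReal_mul, ENNReal.toReal_inv, marginal,
    Measure.map_apply (measurable_restr C) (hm _), Measure.map_apply (measurable_restr C) (hm _),
    e1, e2]
  rfl

/-- For `d = 0` both sides vanish, on the right because `r - 1` is positive. -/
theorem mul_prod_inv_mul_eq {r : ℕ} (hr : 2 ≤ r) (d : ℝ) (c : Fin r → ℝ) :
    d * ∏ i, (d⁻¹ * c i) = (d ^ (r - 1))⁻¹ * ∏ i, c i := by
  rw [Finset.prod_mul_distrib, Finset.prod_const, Finset.card_univ, Fintype.card_fin, ← mul_assoc]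
  congr 1
  obtain ⟨n, rfl⟩ : ∃ n, r = n + 2 := ⟨r - 2, by omega⟩
  by_cases hd : d = 0
  · simp [hd]
  · rw [show n + 2 - 1 = n + 1 by omega]
    rw [inv_pow, pow_succ' d (n + 1), mul_inv, ← mul_assoc, mul_inv_cancel₀ hd, one_mul]

theorem symmetrizedMarkov_of_agreeOn {q : ℕ} [G.LocallyFinite] (hG : G.IsTree) (hq : 1 ≤ q)
    (hreg : G.IsRegularOfDegree (q + 1)) {k : ℕ} {P : ℕ → Set V → Measure (V → Ω)}
    (hP : ∀ n, IsLevelFamily G (k + n) (P n))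
    (hext : ∀ n, IsMarkovExtension G (k + n) (P n) (P (n + 1))) {μ : Measure (V → Ω)}
    (hμ : ∀ m A, IsFullSet G (k + m) A → AgreeOn A μ (P m A)) {j : ℕ} (hj : k ≤ j) :
    SymmetrizedMarkov G q j μ := by
  obtain ⟨m, rfl⟩ := Nat.exists_eq_add_of_le hj
  set j := k + m with hjdef
  intro S T hS hT
  rw [isFull_iff hG hq hreg] at hS hT
  obtain ⟨S, hS, rfl⟩ := hS
  obtain ⟨T, hT, rfl⟩ := hT
  have hs := hS.isSunflower hG hq hreg
  have := hs.finite.fintype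
  let e : Fin (numCopies q j) ≃ subFull G j S :=
    (Fintype.equivFinOfCardEq
      (by rw [← hs.ncard, ← Nat.card_coe_set_eq, Nat.card_eq_fintype_card])).symm
  have hD : ⨅ i, indSub G (e i : Set V) = indSub G (core G j S) := by
    rw [iInf_indSub]
    congr 1
    rw [core, Set.sInter_eq_iInter]
    exact e.iInf_comp (g := fun C : subFull G j S => (C : Set V))
  have hfin : ∀ i, (e i : Set V).Finite := fun i => (e i).2.1.finite hG.connected
  obtain ⟨C₀, hC₀, -⟩ := hs.exists_ne hq
  have hDfin : (core G j S).Finite := (hC₀.1.finite hG.connected).subset (core_subset hC₀)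
  refine ⟨fun i => indSub G (e i), indSub G (core G j S), ?_, ?_, hD.symm, ?_, ?_, ?_, ?_⟩
  · intro i i' h
    exact e.injective (Subtype.ext (congrArg SimpleGraph.Subgraph.verts h))
  · ext K
    constructor
    · rintro ⟨i, rfl⟩
      exact ⟨(isFull_indSub_iff hG hq hreg).2 (e i).2.1, indSub_mono_iff.2 (e i).2.2⟩
    · rintro ⟨hK, hKS⟩
      obtain ⟨A, hA, rfl⟩ := (isFull_iff hG hq hreg).1 hK
      exact ⟨e.symm ⟨A, hA, indSub_mono_iff.1 hKS⟩, by simp⟩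
  · intro h0
    have : core G j S = ∅ := by
      rw [h0] at hS ⊢
      exact core_zero hG hq hreg hS
    rw [this, indSub_empty]
  · intro l hl
    rw [isFull_indSub_iff hG hq hreg]
    rw [hl] at hS ⊢
    exact isFullSet_core hG hq hreg hS
  · intro i
    obtain ⟨f, hf, hfT⟩ := (e i).2.1.exists_isometricOn hG hreg hT
    exact ⟨hf.iso hG.connected hfT⟩
  · intro φ η
    -- Any isomorphism of balls is isometric, so equivariance makes the copy the actual marginal on
    -- the petal.
    have hcopy : ∀ i, copy (φ i) (marginal μ (indSub G T)) = marginal μ (indSub G (e i)) := by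
      intro i
      obtain ⟨f, hf, -, hφ⟩ := exists_isometricOn_of_iso hG ((e i).2.1.geodConvex hG)
        (hT.geodConvex hG) (φ i)
      rw [copy_marginal_eq_map μ (φ i) hφ]
      exact marginal_eq_of_agreeOn (agreeOn_map_comp hG hreg hP hμ (e i).2.1 hf)
    have hmarkov : IsMarkov G j S μ :=
      ((hext m).markov S hS).congr hG hq hreg hS (hμ (m + 1) S hS).symm
    have hformula := hmarkov.real_eq e η
    simp only [hcopy]
    rw [marginal_real_singleton μ (hS.finite hG.connected) η, marginal_real_singleton μ hDfin η]
    refine ⟨?_, ?_⟩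
    · refine (hformula.trans (mul_prod_inv_mul_eq (two_le_numCopies hq j) _ _)).trans ?_
      refine congrArg _ ?_
      exact Finset.prod_congr rfl fun i _ => (marginal_real_singleton μ (H := indSub G (e i)) (hfin i) η).symm
    · refine hformula.trans (congrArg _ ?_)
      exact Finset.prod_congr rfl fun i _ =>
        (cond_marginal_real μ (C := indSub G (e i)) (hfin i) (core_subset (e i).2) η).symm

end Subgraphs

end BetheExtension

theorem mainTheorem4 {V : Type*} {Ω : Type*} [Finite Ω] [MeasurableSpace Ω]
    [DiscreteMeasurableSpace Ω] (q : ℕ) (hq : 1 ≤ q) (G : SimpleGraph V) [G.LocallyFinite]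
    (hG : BetheExtension.IsBetheLattice q G) (k : ℕ) (T : G.Subgraph)
    (hT : BetheExtension.IsFull k T) (μk : Measure (BetheExtension.Config Ω T))
    [IsProbabilityMeasure μk] (hμk : BetheExtension.LocallyInvariant T μk) :
    ∃ μ : Measure (V → Ω), IsProbabilityMeasure μ ∧
      BetheExtension.Invariant G μ ∧
      BetheExtension.marginal μ T = μk ∧
      ∀ j : ℕ, k ≤ j → BetheExtension.SymmetrizedMarkov G q j μ := by
  open BetheExtension in
  rw [isFull_iff hG.isTree hq hG.regular] at hT
  obtain ⟨T, hT, rfl⟩ := hT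
  -- A default symbol, needed to extend configurations beyond `T`, exists because `T` is nonempty
  -- and `μk` has mass one.
  have hΩ : Nonempty Ω := by
    obtain ⟨x, hx⟩ := hT.nonempty
    obtain ⟨ξ⟩ := nonempty_of_isProbabilityMeasure μk
    exact ⟨ξ ⟨x, hx⟩⟩
  have hM : IsProbabilityMeasure (μk.map (extendConfig (indSub G T))) :=
    Measure.isProbabilityMeasure_map (measurable_extendConfig _).aemeasurable
  obtain ⟨P₀, hP₀, hPT⟩ := exists_isLevelFamily hG.isTree hq hG.regular hT _
    (hμk.isIsometryInvariant hG.isTree)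
  obtain ⟨P, rfl, hP, hext⟩ := exists_isMarkovExtension_seq hG.isTree hq hG.regular hP₀
  obtain ⟨μ, hμp, hμ⟩ := exists_measure_agreeOn hG.isTree hq hG.regular hP hext
  refine ⟨μ, hμp, map_comp_eq_of_agreeOn hG.isTree hq hG.regular hP hμ, ?_, fun j hj =>
    symmetrizedMarkov_of_agreeOn hG.isTree hq hG.regular hP hext hμ hj⟩
  rw [marginal_eq_of_agreeOn ((hμ 0 T hT).trans hPT), marginal_map_extendConfig]
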